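/- Assume $\mathsf{MA}(\sigma\text{-centered})$, i.e. for every non-empty $\sigma$-centered poset $\mathbb{P}$ (one that is a union of countably many subsets, each of whose finite subsets has a lower bound in $\mathbb{P}$) and every family $\mathcal{D}$ of fewer than $\mathfrak{c}$ dense subsets of $\mathbb{P}$ there is a filter on $\mathbb{P}$ meeting every member of $\mathcal{D}$. Call a separable metrizable space $Z$ countable dense homogeneous if for all countable dense $A,B\subseteq Z$ there is a homeomorphism $h:Z\to Z$ with $h[A]=B$. Then there exists a zero-dimensional separable metrizable space $X$ (a subspace of the Cantor set $2^\omega$) such that $X$ is countable dense homogeneous, while $X^2$ is not. Furthermore, $X$ can be chosen to be, in addition, homogeneous (for all $x,y\in X$ there is a homeomorphism $h:X\to X$ with $h(x)=y$) and completely Baire (every closed subspace of $X$ is a Baire space). -/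

import Mathlib

/-- A subset of a forcing poset is dense if every condition has an extension in it
(smaller conditions are stronger). -/
def IsForcingDense {P : Type*} [Preorder P] (D : Set P) : Prop :=
  ∀ p : P, ∃ q ∈ D, q ≤ p

/-- A subset of a poset is centered if each of its finite subsets has a lower bound in the
whole poset. -/
def IsCentered {P : Type*} [Preorder P] (C : Set P) : Prop :=
  ∀ F : Set P, F.Finite → F ⊆ C → ∃ q : P, ∀ p ∈ F, q ≤ p

/-- A poset is σ-centered if it is a union of countably many centered subsets. -/
def IsSigmaCentered (P : Type*) [Preorder P] : Prop :=
  ∃ C : ℕ → Set P, (∀ n, IsCentered (C n)) ∧ ⋃ n, C n = Set.univ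

/-- Martin's Axiom for σ-centered posets: for every nonempty σ-centered poset and every family of
fewer than continuum many dense subsets, there is a filter that meets all of them. -/
def MASigmaCentered : Prop :=
  ∀ (P : Type) [Preorder P] [Nonempty P], IsSigmaCentered P →
    ∀ 𝒟 : Set (Set P), (∀ D ∈ 𝒟, IsForcingDense D) → Cardinal.mk 𝒟 < Cardinal.continuum →
      ∃ G : Order.PFilter P, ∀ D ∈ 𝒟, ∃ p ∈ D, p ∈ G

/-- Every countable (possibly finite) dense subset is mapped onto every other one by some
self-homeomorphism of the space. -/
def IsCountableDenseHomogeneous (X : Type*) [TopologicalSpace X] : Prop :=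
  ∀ A B : Set X, A.Countable → Dense A → B.Countable → Dense B → ∃ h : X ≃ₜ X, h '' A = B

/-- Every point is mapped to every other point by some self-homeomorphism of the space. -/
def IsHomogeneousSpace (X : Type*) [TopologicalSpace X] : Prop :=
  ∀ x y : X, ∃ h : X ≃ₜ X, h x = y

/-- Every closed subspace is a Baire space. -/
def IsCompletelyBaire (X : Type*) [TopologicalSpace X] : Prop :=
  ∀ C : Set X, IsClosed C → BaireSpace C

/-- The clopen subsets form a base of the topology. -/
def IsZeroDimensional (X : Type*) [TopologicalSpace X] : Prop :=
  TopologicalSpace.IsTopologicalBasis {s : Set X | IsClopen s}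

/-!
The space is built inside `V = ℕ → ZMod 3`, which embeds in `ℕ → Bool`, by a transfinite recursion
of length `𝔠`. At each stage there are fewer than `𝔠` many homeomorphisms of `V`, generating a group
together with the translations by finitely supported sequences, fewer than `𝔠` many points promised
to the space and fewer than `𝔠` many points promised to its complement, so that no orbit of the
group contains points of both kinds (`hull` is the union of the orbits). The final space `X` is the
union of the orbits of the points promised to it. The only use of Martin's Axiom is that fewer than
`𝔠` many closed sets with empty interior do not cover a compact metrizable space
(`MASigmaCentered.exists_forall_notMem`), which follows from it for a countable poset.

*Countable dense homogeneity.* Given countable dense `A`, `B` disjoint from the orbits promised to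
the complement, a homeomorphism of `V` with `h '' A = B` is adjoined. A tree automorphism
straightens each of `A` and `B` to the set of eventually zero sequences (`straighten`). Between the
two straightenings stands a `twist`, which changes the signs of terms according to a parameter `f` in
the Cantor cube `List (ZMod 3) → Bool`, and which preserves the eventually zero sequences for every
`f`. For generic `f` no word in `h` and the old group leads from a point promised to the space to a
point promised to the complement: along a shortest such word the last edge of the graph of `h` is
new and starts outside `A`, so a small change of `f` moves its endpoint alone
(`interior_evalWord_eq`).

*The square.* A continuous function of two variables is coded by the closure `C` of a countable part
of its graph. Either the function depends on one variable only in some box, or a generic pair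
`(x, y)` with `(x, y, v) ∈ C` has `v` outside the orbits of `x`, of `y` and of the promised points;
then `x` and `y` are promised to the space and `v` to the complement
(`MASigmaCentered.exists_pair_increment`). Hence every continuous function from `X × X` to `X`
depends on one variable only in some box, which no first component of a homeomorphism does that maps
a product `A × A` onto a dense set on which the first coordinate is injective.

*Homogeneity and the Baire property.* In a countable dense homogeneous space orbits are open, and
the finitely supported translations carry each point of `X` into each open set. As `X` meets every
Borel set of cardinality `𝔠`, a countable intersection of dense open sets in a closed subspace of
`X`, extended to the closure in `V`, contains points of `X`.
-/

open Set Topology Filter Cardinal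

/-! ### Martin's Axiom and category; cardinality of generated groups -/

/-- Fewer than `𝔠` many closed sets with empty interior do not cover a compact second-countable
Hausdorff space: a point in the closures of the members of a sufficiently generic filter of basic
open sets avoids them all. -/
theorem MASigmaCentered.exists_forall_notMem (hMA : MASigmaCentered) {W : Type}
    [TopologicalSpace W] [CompactSpace W] [T2Space W] [SecondCountableTopology W] [Nonempty W]
    {I : Type} (N : I → Set W) (hc : ∀ i, IsClosed (N i)) (hi : ∀ i, interior (N i) = ∅)
    (hI : #I < 𝔠) : ∃ w, ∀ i, w ∉ N i := by
  classical
  let P : Type := TopologicalSpace.countableBasis W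
  have hbasis := TopologicalSpace.isBasis_countableBasis W
  have hctb : Countable P := (TopologicalSpace.countable_countableBasis W).to_subtype
  have hne : ∀ p : P, (p : Set W).Nonempty := fun p =>
    TopologicalSpace.nonempty_of_mem_countableBasis p.2
  have hsmall : ∀ O : Set W, IsOpen O → O.Nonempty → ∃ p : P, closure (p : Set W) ⊆ O := by
    rintro O hO ⟨x, hx⟩
    obtain ⟨C, hC, hCc, hCO⟩ := exists_mem_nhds_isClosed_subset (hO.mem_nhds hx)
    obtain ⟨U, hU, -, hUC⟩ := hbasis.mem_nhds_iff.1 hC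
    exact ⟨⟨U, hU⟩, (closure_minimal hUC hCc).trans hCO⟩
  have : Nonempty P := by
    obtain ⟨p, -⟩ := hsmall univ isOpen_univ univ_nonempty
    exact ⟨p⟩
  have hsc : IsSigmaCentered P := by
    obtain ⟨e, he⟩ := exists_surjective_nat P
    refine ⟨fun n => {e n}, fun n F _ hF => ⟨e n, fun p hp => (hF hp).ge⟩, ?_⟩
    ext p
    obtain ⟨n, rfl⟩ := he p
    simp
  let D : I → Set P := fun i => {p | Disjoint (closure (p : Set W)) (N i)}
  obtain ⟨G, hG⟩ := hMA P hsc (range D) (by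
    rintro _ ⟨i, rfl⟩ p
    have hop : IsOpen ((p : Set W) \ N i) :=
      (TopologicalSpace.isOpen_of_mem_countableBasis p.2).sdiff (hc i)
    have hnon : ((p : Set W) \ N i).Nonempty := by
      by_contra h
      rw [not_nonempty_iff_eq_empty, sdiff_eq_empty] at h
      have := interior_maximal h (TopologicalSpace.isOpen_of_mem_countableBasis p.2)
      rw [hi i] at this
      obtain ⟨x, hx⟩ := hne p
      exact this hx
    obtain ⟨q, hq⟩ := hsmall _ hop hnon
    exact ⟨q, disjoint_left.2 fun x hx => (hq hx).2, fun x hx => (hq (subset_closure hx)).1⟩)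
    (mk_range_le.trans_lt hI)
  obtain ⟨w, hw⟩ : (⋂ p : (G : Set P), closure ((p : P) : Set W)).Nonempty := by
    have : Nonempty (G : Set P) := G.nonempty.to_subtype
    apply IsCompact.nonempty_iInter_of_directed_nonempty_isCompact_isClosed
    · rintro ⟨p, hp⟩ ⟨q, hq⟩
      obtain ⟨r, hr, hrp, hrq⟩ := G.directed p hp q hq
      exact ⟨⟨r, hr⟩, closure_mono hrp, closure_mono hrq⟩
    · exact fun p => (hne p).closure
    · exact fun p => isClosed_closure.isCompact
    · exact fun p => isClosed_closure
  refine ⟨w, fun i hwi => ?_⟩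
  obtain ⟨p, hpD, hpG⟩ := hG (D i) ⟨i, rfl⟩
  exact disjoint_left.1 hpD (mem_iInter.1 hw ⟨p, hpG⟩) hwi

theorem mk_subgroup_closure_lt {Γ : Type} [Group Γ] {κ : Cardinal} (hκ : ℵ₀ < κ) {S : Set Γ}
    (hS : #S < κ) : #(Subgroup.closure S) < κ := by
  have h : (Subgroup.closure S : Set Γ) ⊆ range (FreeGroup.lift ((↑) : S → Γ)) := by
    intro x hx
    have : x ∈ (FreeGroup.lift ((↑) : S → Γ)).range := by
      rw [FreeGroup.range_lift_eq_closure]; simpa using hx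
    exact this
  refine ((mk_le_mk_of_subset h).trans mk_range_le).trans_lt ?_
  rcases isEmpty_or_nonempty S with h | h
  · exact (mk_le_aleph0 (α := FreeGroup S)).trans_lt hκ
  · rw [mk_freeGroup]
    exact max_lt hS hκ

/-! ### Automorphisms of the ternary tree -/

/-- The finite sequence `x 0, …, x (n - 1)`, written in reverse order so that extending it by one
term is `List.cons`. -/
def initSeg (x : ℕ → ZMod 3) : ℕ → List (ZMod 3)
  | 0 => []
  | n + 1 => x n :: initSeg x n

theorem initSeg_eq_iff {x y : ℕ → ZMod 3} {n : ℕ} :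
    initSeg x n = initSeg y n ↔ ∀ i < n, x i = y i := by
  induction n with
  | zero => simp [initSeg]
  | succ n ih =>
    simp only [initSeg, List.cons.injEq, ih, Nat.lt_succ_iff_lt_or_eq, or_imp, forall_and,
      forall_eq, and_comm]

theorem length_initSeg (x : ℕ → ZMod 3) (n : ℕ) : (initSeg x n).length = n := by
  induction n with
  | zero => rfl
  | succ n ih => simp [initSeg, ih]

theorem eventually_initSeg_eq (x : ℕ → ZMod 3) (n : ℕ) :
    ∀ᶠ y in 𝓝 x, initSeg y n = initSeg x n := by
  simp only [initSeg_eq_iff]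
  have : ∀ i ∈ Iio n, ∀ᶠ y : ℕ → ZMod 3 in 𝓝 x, y i = x i := fun i _ =>
    (continuous_apply i).continuousAt.eventually
      ((isOpen_discrete ({x i} : Set (ZMod 3))).mem_nhds rfl)
  exact (eventually_all_finite (finite_Iio n)).2 this

theorem exists_initSeg_eq (s : List (ZMod 3)) : ∃ x, initSeg x s.length = s := by
  induction s with
  | nil => exact ⟨0, rfl⟩
  | cons a s ih =>
    obtain ⟨x, hx⟩ := ih
    refine ⟨Function.update x s.length a, ?_⟩
    simp only [List.length_cons, initSeg, Function.update_self, List.cons.injEq, true_and]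
    rw [← hx, length_initSeg, initSeg_eq_iff]
    intro i hi
    simp [hi.ne]

/-- The automorphism of the ternary tree that permutes the successors of each node `s` by `P s`. -/
def treeMap (P : List (ZMod 3) → Equiv.Perm (ZMod 3)) (x : ℕ → ZMod 3) : ℕ → ZMod 3 :=
  fun n => P (initSeg x n) (x n)

/-- The initial segments of the preimage of `y` under `treeMap P`. -/
def treeInvSeg (P : List (ZMod 3) → Equiv.Perm (ZMod 3)) (y : ℕ → ZMod 3) : ℕ → List (ZMod 3)
  | 0 => []
  | n + 1 => (P (treeInvSeg P y n)).symm (y n) :: treeInvSeg P y n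

/-- The inverse of `treeMap P`. -/
def treeInv (P : List (ZMod 3) → Equiv.Perm (ZMod 3)) (y : ℕ → ZMod 3) : ℕ → ZMod 3 :=
  fun n => (P (treeInvSeg P y n)).symm (y n)

theorem initSeg_treeInv (P : List (ZMod 3) → Equiv.Perm (ZMod 3)) (y : ℕ → ZMod 3) (n : ℕ) :
    initSeg (treeInv P y) n = treeInvSeg P y n := by
  induction n with
  | zero => rfl
  | succ n ih => simp [initSeg, treeInvSeg, ih, treeInv]

theorem treeInvSeg_treeMap (P : List (ZMod 3) → Equiv.Perm (ZMod 3)) (x : ℕ → ZMod 3) (n : ℕ) :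
    treeInvSeg P (treeMap P x) n = initSeg x n := by
  induction n with
  | zero => rfl
  | succ n ih => simp [initSeg, treeInvSeg, ih, treeMap]

section Continuity

variable {Φ : Type*} [TopologicalSpace Φ] {P : Φ → List (ZMod 3) → Equiv.Perm (ZMod 3)}

theorem eventually_apply_eq (x : ℕ → ZMod 3) (n : ℕ) : ∀ᶠ y : ℕ → ZMod 3 in 𝓝 x, y n = x n :=
  (eventually_initSeg_eq x (n + 1)).mono fun _ hy => initSeg_eq_iff.1 hy n n.lt_succ_self

theorem continuous_of_eventually_apply_eq {Y : Type*} [TopologicalSpace Y] {F : Y → ℕ → ZMod 3}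
    (h : ∀ y n, ∀ᶠ z in 𝓝 y, F z n = F y n) : Continuous F :=
  continuous_pi fun n => continuous_iff_continuousAt.2 fun y =>
    continuousAt_const.congr ((h y n).mono fun _ hz => hz.symm)

theorem continuous_treeMap_param (hP : ∀ f s, ∀ᶠ g in 𝓝 f, P g s = P f s) :
    Continuous fun p : Φ × (ℕ → ZMod 3) => treeMap (P p.1) p.2 := by
  refine continuous_of_eventually_apply_eq fun ⟨f, x⟩ n => ?_
  filter_upwards [(hP f (initSeg x n)).prod_inl_nhds x, (eventually_initSeg_eq x n).prod_inr_nhds f,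
    (eventually_apply_eq x n).prod_inr_nhds f] with p h1 h2 h3
  simp only [treeMap, h2, h1, h3]

theorem continuous_treeInv_param (hP : ∀ f s, ∀ᶠ g in 𝓝 f, P g s = P f s) :
    Continuous fun p : Φ × (ℕ → ZMod 3) => treeInv (P p.1) p.2 := by
  refine continuous_of_eventually_apply_eq fun ⟨f, y⟩ n => ?_
  have key : ∀ n, ∀ᶠ p : Φ × (ℕ → ZMod 3) in 𝓝 (f, y),
      treeInvSeg (P p.1) p.2 n = treeInvSeg (P f) y n := by
    intro n
    induction n with
    | zero => exact Eventually.of_forall fun _ => rfl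
    | succ n ih =>
      filter_upwards [ih, (hP f (treeInvSeg (P f) y n)).prod_inl_nhds y,
        (eventually_apply_eq y n).prod_inr_nhds f] with p h1 h2 h3
      simp only [treeInvSeg, h1, h2, h3]
  filter_upwards [key n, (hP f (treeInvSeg (P f) y n)).prod_inl_nhds y,
    (eventually_apply_eq y n).prod_inr_nhds f] with p h1 h2 h3
  simp only [treeInv, h1, h2, h3]

end Continuity

/-- `treeMap P` as a homeomorphism. -/
def treeHomeo (P : List (ZMod 3) → Equiv.Perm (ZMod 3)) : (ℕ → ZMod 3) ≃ₜ (ℕ → ZMod 3) where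
  toFun := treeMap P
  invFun := treeInv P
  left_inv x := by
    ext1 n
    simp only [treeInv, treeInvSeg_treeMap]
    simp [treeMap]
  right_inv y := by
    ext1 n
    simp only [treeMap, initSeg_treeInv]
    simp [treeInv]
  continuous_toFun := (continuous_treeMap_param (Φ := Unit) (P := fun _ => P)
    (fun _ _ => Eventually.of_forall fun _ => rfl)).comp (Continuous.prodMk_right ())
  continuous_invFun := (continuous_treeInv_param (Φ := Unit) (P := fun _ => P)
    (fun _ _ => Eventually.of_forall fun _ => rfl)).comp (Continuous.prodMk_right ())

/-! ### Straightening a countable dense set -/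

/-- The sequences that are eventually zero. -/
def eventuallyZero : Set (ℕ → ZMod 3) := {x | ∃ N, ∀ n ≥ N, x n = 0}

/-- The least index of a term of `a` that passes through the node `s`. -/
noncomputable def leastIndex (a : ℕ → ℕ → ZMod 3) (s : List (ZMod 3)) : ℕ :=
  sInf {i | initSeg (a i) s.length = s}

theorem leastIndex_spec {a : ℕ → ℕ → ZMod 3} (ha : DenseRange a) (s : List (ZMod 3)) :
    initSeg (a (leastIndex a s)) s.length = s := by
  obtain ⟨x, hx⟩ := exists_initSeg_eq s
  have h := eventually_initSeg_eq x s.length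
  rw [hx] at h
  obtain ⟨-, hy, i, rfl⟩ := mem_closure_iff_nhds.1 (ha x) _ h
  exact Nat.sInf_mem (s := {i | initSeg (a i) s.length = s}) ⟨i, hy⟩

/-- The tree automorphism that turns, at each node `s`, the successor on which the first term
of `a` through `s` lies into the successor `0`. -/
noncomputable def straighten (a : ℕ → ℕ → ZMod 3) : (ℕ → ZMod 3) ≃ₜ (ℕ → ZMod 3) :=
  treeHomeo fun s => Equiv.subRight (a (leastIndex a s) s.length)

theorem straighten_apply (a : ℕ → ℕ → ZMod 3) (x : ℕ → ZMod 3) (n : ℕ) :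
    straighten a x n = x n - a (leastIndex a (initSeg x n)) n := by
  simp [straighten, treeHomeo, treeMap, length_initSeg]

theorem straighten_mem_eventuallyZero {a : ℕ → ℕ → ZMod 3} (ha : DenseRange a)
    {x : ℕ → ZMod 3} : straighten a x ∈ eventuallyZero ↔ x ∈ range a := by
  classical
  constructor
  · rintro ⟨N, hN⟩
    simp only [straighten_apply, sub_eq_zero] at hN
    set i := leastIndex a (initSeg x N) with hi
    have key : ∀ n ≥ N, leastIndex a (initSeg x n) = i ∧ initSeg (a i) n = initSeg x n := by
      intro n hn
      induction n, hn using Nat.le_induction with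
      | base =>
        refine ⟨hi.symm, ?_⟩
        have := leastIndex_spec ha (initSeg x N)
        rwa [length_initSeg] at this
      | succ n hn ih =>
        have h1 : initSeg (a i) (n + 1) = initSeg x (n + 1) := by
          simp only [initSeg, ih.2]
          rw [hN n hn, ih.1]
        refine ⟨le_antisymm ?_ ?_, h1⟩
        · apply Nat.sInf_le
          simpa [length_initSeg] using h1
        · rw [← ih.1]
          apply Nat.sInf_le
          have := leastIndex_spec ha (initSeg x (n + 1))
          rw [length_initSeg] at this
          have := (List.cons.inj this).2
          simpa [length_initSeg] using this
    refine ⟨i, ?_⟩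
    ext1 n
    have := (key (max N (n + 1)) (le_max_left _ _)).2
    exact initSeg_eq_iff.1 this n (lt_of_lt_of_le n.lt_succ_self (le_max_right _ _))
  · intro hx
    have hx' : ∃ i, a i = x := hx
    set i := Nat.find hx' with hi
    have hai : a i = x := Nat.find_spec hx'
    have hlt : ∀ j < i, ∃ n, a j n ≠ x n := fun j hj => by
      have := Nat.find_min hx' hj
      by_contra! h
      exact this (funext h)
    choose! m hm using hlt
    obtain ⟨N, hN⟩ : ∃ N, ∀ j < i, m j < N := by
      refine ⟨(Finset.range i).sup m + 1, fun j hj => Nat.lt_succ_of_le ?_⟩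
      exact Finset.le_sup (f := m) (Finset.mem_range.2 hj)
    refine ⟨N, fun n hn => ?_⟩
    have : leastIndex a (initSeg x n) = i := by
      apply le_antisymm
      · apply Nat.sInf_le
        simp [length_initSeg, hai]
      · by_contra! h
        have h1 := leastIndex_spec ha (initSeg x n)
        rw [length_initSeg] at h1
        exact hm _ h (initSeg_eq_iff.1 h1 _ ((hN _ h).trans_le hn))
    rw [straighten_apply, this, hai, sub_self]

/-! ### Sign twists -/

/-- The permutation `z ↦ -z` at the nodes where `f` is `true`, the identity elsewhere. -/
def signPerm (f : List (ZMod 3) → Bool) (s : List (ZMod 3)) : Equiv.Perm (ZMod 3) :=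
  if f s then Equiv.neg _ else Equiv.refl _

/-- The tree automorphism that changes the sign of `x n` when `f` is `true` at the node
`x 0, …, x (n - 1)`. -/
def twist (f : List (ZMod 3) → Bool) : (ℕ → ZMod 3) ≃ₜ (ℕ → ZMod 3) := treeHomeo (signPerm f)

theorem twist_apply (f : List (ZMod 3) → Bool) (x : ℕ → ZMod 3) (n : ℕ) :
    twist f x n = if f (initSeg x n) then -x n else x n := by
  change signPerm f (initSeg x n) (x n) = _
  unfold signPerm
  split_ifs <;> simp

theorem twist_mem_eventuallyZero {f : List (ZMod 3) → Bool} {x : ℕ → ZMod 3} :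
    twist f x ∈ eventuallyZero ↔ x ∈ eventuallyZero := by
  have : ∀ n, twist f x n = 0 ↔ x n = 0 := fun n => by
    rw [twist_apply]; split_ifs <;> simp
  simp [eventuallyZero, this]

theorem eventually_signPerm_eq (f : List (ZMod 3) → Bool) (s : List (ZMod 3)) :
    ∀ᶠ g in 𝓝 f, signPerm g s = signPerm f s := by
  have : ∀ᶠ g : List (ZMod 3) → Bool in 𝓝 f, g s = f s :=
    (continuous_apply s).continuousAt.eventually ((isOpen_discrete ({f s} : Set Bool)).mem_nhds rfl)
  filter_upwards [this] with g hg
  simp [signPerm, hg]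

theorem continuous_twist : Continuous fun p : (List (ZMod 3) → Bool) × (ℕ → ZMod 3) =>
    twist p.1 p.2 :=
  continuous_treeMap_param eventually_signPerm_eq

theorem continuous_twist_symm : Continuous fun p : (List (ZMod 3) → Bool) × (ℕ → ZMod 3) =>
    (twist p.1).symm p.2 :=
  continuous_treeInv_param eventually_signPerm_eq

/-- The value of `twist f` at a single point outside `eventuallyZero` can be changed by an
arbitrarily small change of `f` that keeps its values at finitely many other points: the sign is
changed at one node high up on that point. -/
theorem exists_twist_ne {f : List (ZMod 3) → Bool} {O : Set (List (ZMod 3) → Bool)} (hO : IsOpen O)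
    (hf : f ∈ O) {c : ℕ → ZMod 3} (hc : c ∉ eventuallyZero) {S : Set (ℕ → ZMod 3)}
    (hS : S.Finite) (hcS : c ∉ S) :
    ∃ f' ∈ O, twist f' c ≠ twist f c ∧ ∀ d ∈ S, twist f' d = twist f d := by
  classical
  obtain ⟨J, u, hu, hJ⟩ := isOpen_pi_iff.1 hO f hf
  have h1 : ∀ᶠ m in atTop, ∀ s ∈ (J : Set (List (ZMod 3))), s.length < m :=
    (eventually_all_finite J.finite_toSet).2 fun s _ => eventually_gt_atTop _
  have h2 : ∀ᶠ m in atTop, ∀ d ∈ S, initSeg d m ≠ initSeg c m := by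
    refine (eventually_all_finite hS).2 fun d hd => ?_
    obtain ⟨n, hn⟩ := Function.ne_iff.1 (ne_of_mem_of_not_mem hd hcS)
    filter_upwards [eventually_gt_atTop n] with m hm h
    exact hn (initSeg_eq_iff.1 h n hm)
  obtain ⟨M, hM⟩ := eventually_atTop.1 (h1.and h2)
  obtain ⟨m, hmM, hcm⟩ : ∃ m ≥ M, c m ≠ 0 := by
    simpa [eventuallyZero] using (not_exists.1 hc M)
  refine ⟨Function.update f (initSeg c m) (!f (initSeg c m)), hJ fun s hs => ?_, fun h => ?_,
    fun d hd => ?_⟩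
  · have : s ≠ initSeg c m := fun h => by
      have := (hM m hmM).1 s hs
      rw [h, length_initSeg] at this
      exact lt_irrefl _ this
    rw [Function.update_of_ne this]
    exact (hu s hs).2
  · have hneg : -c m ≠ c m := by
      generalize c m = z at hcm
      revert z; decide
    have := congrFun h m
    simp only [twist_apply, Function.update_self] at this
    cases hfc : f (initSeg c m) <;> simp [hfc, hneg, hneg.symm] at this
  · ext1 n
    have : initSeg d n ≠ initSeg c m := fun h => by
      have hnm : n = m := by simpa [length_initSeg] using congrArg List.length h
      subst hnm
      exact (hM n hmM).2 d hd h
    simp only [twist_apply, Function.update_of_ne this]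

/-- A family of homeomorphisms that map `range a` onto `range b`, when both sequences are dense. -/
noncomputable def transfer (a b : ℕ → ℕ → ZMod 3) (f : List (ZMod 3) → Bool) :
    (ℕ → ZMod 3) ≃ₜ (ℕ → ZMod 3) :=
  ((straighten a).trans (twist f)).trans (straighten b).symm

theorem transfer_mem_range {a b : ℕ → ℕ → ZMod 3} (ha : DenseRange a) (hb : DenseRange b)
    (f : List (ZMod 3) → Bool) (x : ℕ → ZMod 3) : transfer a b f x ∈ range b ↔ x ∈ range a := by
  rw [← straighten_mem_eventuallyZero ha, ← straighten_mem_eventuallyZero hb]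
  simp [transfer, twist_mem_eventuallyZero]

theorem continuous_transfer (a b : ℕ → ℕ → ZMod 3) :
    Continuous fun p : (List (ZMod 3) → Bool) × (ℕ → ZMod 3) => transfer a b p.1 p.2 :=
  (straighten b).symm.continuous.comp
    (continuous_twist.comp (continuous_fst.prodMk ((straighten a).continuous.comp continuous_snd)))

theorem continuous_transfer_symm (a b : ℕ → ℕ → ZMod 3) :
    Continuous fun p : (List (ZMod 3) → Bool) × (ℕ → ZMod 3) => (transfer a b p.1).symm p.2 :=
  (straighten a).symm.continuous.comp (continuous_twist_symm.comp
    (continuous_fst.prodMk ((straighten b).continuous.comp continuous_snd)))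

theorem exists_transfer_ne {a b : ℕ → ℕ → ZMod 3} (ha : DenseRange a)
    {f : List (ZMod 3) → Bool} {O : Set (List (ZMod 3) → Bool)} (hO : IsOpen O)
    (hf : f ∈ O) {c : ℕ → ZMod 3} (hc : c ∉ range a) {S : Set (ℕ → ZMod 3)}
    (hS : S.Finite) (hcS : c ∉ S) :
    ∃ f' ∈ O, transfer a b f' c ≠ transfer a b f c ∧
      ∀ d ∈ S, transfer a b f' d = transfer a b f d := by
  obtain ⟨f', hf', h1, h2⟩ := exists_twist_ne hO hf
    (mt (straighten_mem_eventuallyZero ha).1 hc) (hS.image (straighten a))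
    (by simpa using hcS)
  exact ⟨f', hf', by simpa [transfer] using h1,
    fun d hd => by simpa [transfer] using h2 _ (mem_image_of_mem _ hd)⟩

/-! ### Adjoining a generic homeomorphism -/

section Words

variable {V Φ : Type} [TopologicalSpace V] {H : Subgroup (V ≃ₜ V)}
  (h : Φ → V ≃ₜ V)

/-- One of the two homeomorphisms `h f` and its inverse. -/
def stepHomeo (f : Φ) (e : Bool) : V ≃ₜ V := if e then h f else (h f).symm

/-- The action on `x` of the word `g₁ h^±1 g₂ h^±1 ⋯` with letters `gᵢ` in `H`. -/
def evalWord (f : Φ) (x : V) : List (H × Bool) → V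
  | [] => x
  | (g, e) :: w => (g : V ≃ₜ V) (stepHomeo h f e (evalWord f x w))

/-- The endpoint that lies in the domain, for the edge `{p, h p}` or `{h⁻¹ p, p}` of the
graph of `h f` that `stepHomeo h f e` traverses from `p`. -/
def edgeSource (f : Φ) (e : Bool) (p : V) : V := if e then p else (h f).symm p

/-- The sources of the edges of the graph of `h f` that are traversed along a word. -/
def edgeSources (f : Φ) (x : V) : List (H × Bool) → List V
  | [] => []
  | (_, e) :: w => edgeSource h f e (evalWord h f x w) :: edgeSources f x w

variable {h}

theorem mem_edgeSources {f : Φ} {x d : V} {w : List (H × Bool)} (hd : d ∈ edgeSources h f x w) :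
    ∃ g e u, (g, e) :: u <:+ w ∧ d = edgeSource h f e (evalWord h f x u) := by
  induction w with
  | nil => simp [edgeSources] at hd
  | cons l w ih =>
    obtain ⟨g, e⟩ := l
    rcases List.mem_cons.1 hd with rfl | hd
    · exact ⟨g, e, w, List.suffix_refl _, rfl⟩
    · obtain ⟨g', e', u, hu, rfl⟩ := ih hd
      exact ⟨g', e', u, hu.trans (List.suffix_cons _ _), rfl⟩

theorem stepHomeo_eq_of_edgeSource {f f' : Φ} {e : Bool} {p : V}
    (hp : h f' (edgeSource h f e p) = h f (edgeSource h f e p)) :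
    stepHomeo h f' e p = stepHomeo h f e p := by
  cases e
  · simp only [edgeSource, Bool.false_eq_true, if_false, Homeomorph.apply_symm_apply] at hp
    simp only [stepHomeo, Bool.false_eq_true, if_false]
    rw [Homeomorph.symm_apply_eq]; exact hp.symm
  · exact hp

theorem edgeSource_eq_of_stepHomeo {f f' : Φ} {e : Bool} {p : V}
    (hp : stepHomeo h f' e p = stepHomeo h f e p) :
    h f' (edgeSource h f e p) = h f (edgeSource h f e p) := by
  cases e
  · simp only [stepHomeo, Bool.false_eq_true, if_false] at hp
    simp only [edgeSource, Bool.false_eq_true, if_false, Homeomorph.apply_symm_apply]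
    rw [← hp, Homeomorph.apply_symm_apply]
  · exact hp

theorem evalWord_congr {f f' : Φ} {x : V} {w : List (H × Bool)}
    (hw : ∀ d ∈ edgeSources h f x w, h f' d = h f d) : evalWord h f' x w = evalWord h f x w := by
  induction w with
  | nil => rfl
  | cons l w ih =>
    obtain ⟨g, e⟩ := l
    simp only [edgeSources, List.mem_cons, forall_eq_or_imp] at hw
    simp only [evalWord, ih hw.2, stepHomeo_eq_of_edgeSource hw.1]

/-- Two edges with the same source are the same edge, so that the second endpoint of the one
is one of the two endpoints of the other. -/
theorem stepHomeo_eq_or {f : Φ} {e e' : Bool} {p p' : V}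
    (he : edgeSource h f e p = edgeSource h f e' p') :
    stepHomeo h f e p = p' ∨ stepHomeo h f e p = stepHomeo h f e' p' := by
  cases e <;> cases e' <;>
    simp_all [edgeSource, stepHomeo]

variable [TopologicalSpace Φ]

theorem continuous_evalWord (h1 : Continuous fun p : Φ × V => h p.1 p.2)
    (h2 : Continuous fun p : Φ × V => (h p.1).symm p.2) (x : V) (w : List (H × Bool)) :
    Continuous fun f => evalWord h f x w := by
  induction w with
  | nil => exact continuous_const
  | cons l w ih =>
    obtain ⟨g, e⟩ := l
    refine (g : V ≃ₜ V).continuous.comp ?_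
    cases e
    · exact h2.comp (continuous_id.prodMk ih)
    · exact h1.comp (continuous_id.prodMk ih)

variable [T2Space V] [CompactSpace Φ] [T2Space Φ] {A B X Y : Set V}

/-- No word takes a given point of `X` to a given point of `Y` for an open set of parameters. By
induction one may avoid the parameters for which a shorter word leads into `Y`; then the last edge
traversed differs from all previous ones and does not start in `A`, and moving it alone moves the
endpoint. -/
theorem interior_evalWord_eq (h1 : Continuous fun p : Φ × V => h p.1 p.2)
    (h2 : Continuous fun p : Φ × V => (h p.1).symm p.2) (hAB : ∀ f x, h f x ∈ B ↔ x ∈ A)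
    (hne : ∀ (f : Φ) (O : Set Φ), IsOpen O → f ∈ O → ∀ c ∉ A, ∀ S : Set V, S.Finite → c ∉ S →
      ∃ f' ∈ O, h f' c ≠ h f c ∧ ∀ d ∈ S, h f' d = h f d)
    (hX : A ⊆ X) (hX' : B ⊆ X) (hY : ∀ g ∈ H, ∀ y ∈ Y, g y ∈ Y) (hXY : Disjoint X Y)
    {x : V} (hx : x ∈ X) (w : List (H × Bool)) {y : V} (hy : y ∈ Y) :
    interior {f | evalWord h f x w = y} = ∅ := by
  induction hn : w.length using Nat.strong_induction_on generalizing w y with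
  | _ n ih =>
  subst hn
  rcases w with _ | ⟨⟨g, e⟩, w⟩
  · have : ∀ f, evalWord h f x ([] : List (H × Bool)) ≠ y :=
      fun f hf => disjoint_left.1 hXY hx (by rw [show x = y from hf]; exact hy)
    simp [this]
  by_contra hO
  replace hO := nonempty_iff_ne_empty.2 hO
  have hq : (g⁻¹ : V ≃ₜ V) y ∈ Y := hY _ (H.inv_mem g.2) _ hy
  -- the shorter words that a repeated edge would leave
  let W : Set (List (H × Bool)) := {v | v ∈ w.tails} ∪ {v | ∃ g e u, (g, e) :: u ∈ w.tails ∧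
    v = (1, e) :: u}
  have hWfin : W.Countable := by
    refine ((List.finite_toSet w.tails).countable).union (Countable.mono ?_
      ((List.finite_toSet w.tails).countable.image
        fun v => match v with | [] => [] | (_, e) :: u => (1, e) :: u))
    rintro _ ⟨g, e, u, hu, rfl⟩
    exact ⟨_, hu, rfl⟩
  have hWlen : ∀ v ∈ W, v.length < ((g, e) :: w).length := by
    rintro v (hv | ⟨g', e', u, hu, rfl⟩)
    · exact Nat.lt_succ_of_le ((List.mem_tails _ _).1 hv).length_le
    · have := ((List.mem_tails _ _).1 hu).length_le
      simp only [List.length_cons] at this ⊢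
      omega
  have hclosed : ∀ v : List (H × Bool), IsClosed {f | evalWord h f x v = (g⁻¹ : V ≃ₜ V) y} :=
    fun v => isClosed_eq (continuous_evalWord h1 h2 x v) continuous_const
  have hdense := dense_biInter_of_isOpen
    (f := fun v : List (H × Bool) => {f | evalWord h f x v = (g⁻¹ : V ≃ₜ V) y}ᶜ)
    (fun v _ => (hclosed v).isOpen_compl) hWfin fun v hv => by
      rw [← interior_eq_empty_iff_dense_compl]
      exact ih _ (hWlen v hv) v hq rfl
  obtain ⟨f, hfO, hf⟩ := hdense.inter_open_nonempty _ isOpen_interior hO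
  simp only [mem_iInter, mem_compl_iff, mem_ofPred_eq] at hf
  set p := evalWord h f x w with hp
  have hfy : (g : V ≃ₜ V) (stepHomeo h f e p) = y := by
    simpa only [mem_ofPred_eq, evalWord, ← hp] using interior_subset hfO
  have hstep : stepHomeo h f e p = (g⁻¹ : V ≃ₜ V) y := by
    rw [← hfy, ← Homeomorph.mul_apply, inv_mul_cancel, Homeomorph.one_apply]
  have hsY : stepHomeo h f e p ∈ Y := hstep ▸ hq
  have hsA : edgeSource h f e p ∉ A := by
    intro ha
    refine disjoint_left.1 hXY ?_ hsY
    cases e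
    · exact hX ha
    · exact hX' ((hAB _ _).2 ha)
  have hsS : edgeSource h f e p ∉ {d | d ∈ edgeSources h f x w} := by
    intro hs
    obtain ⟨g', e', u, hu, he⟩ := mem_edgeSources hs
    have hu' := (List.mem_tails _ _).2 hu
    rcases stepHomeo_eq_or he with h' | h'
    · exact hf u (Or.inl ((List.mem_tails _ _).2 ((List.suffix_cons _ _).trans hu)))
        (h'.symm.trans hstep)
    · exact hf ((1, e') :: u) (Or.inr ⟨g', e', u, hu', rfl⟩) (h'.symm.trans hstep)
  obtain ⟨f', hf'O, hf'ne, hf'eq⟩ := hne f _ isOpen_interior hfO _ hsA _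
    (List.finite_toSet _) hsS
  have hf'y : (g : V ≃ₜ V) (stepHomeo h f' e (evalWord h f' x w)) = y := by
    simpa only [mem_ofPred_eq, evalWord] using interior_subset hf'O
  rw [evalWord_congr hf'eq, ← hp, ← hfy] at hf'y
  exact hf'ne (edgeSource_eq_of_stepHomeo ((g : V ≃ₜ V).injective hf'y))

variable [SecondCountableTopology Φ] [Nonempty Φ]

/-- For a generic parameter `f`, the group generated by `H` and `h f` leads from no point of `X` to
a point of `Y`. -/
theorem MASigmaCentered.exists_forall_closure_insert (hMA : MASigmaCentered)
    (h1 : Continuous fun p : Φ × V => h p.1 p.2)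
    (h2 : Continuous fun p : Φ × V => (h p.1).symm p.2) (hAB : ∀ f x, h f x ∈ B ↔ x ∈ A)
    (hne : ∀ (f : Φ) (O : Set Φ), IsOpen O → f ∈ O → ∀ c ∉ A, ∀ S : Set V, S.Finite → c ∉ S →
      ∃ f' ∈ O, h f' c ≠ h f c ∧ ∀ d ∈ S, h f' d = h f d)
    (hX : A ⊆ X) (hX' : B ⊆ X) (hXH : ∀ g ∈ H, ∀ x ∈ X, g x ∈ X)
    (hY : ∀ g ∈ H, ∀ y ∈ Y, g y ∈ Y) (hXY : Disjoint X Y)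
    (hH : #H < 𝔠) (hXc : #X < 𝔠) (hYc : #Y < 𝔠) :
    ∃ f, ∀ g ∈ Subgroup.closure (insert (h f) (H : Set (V ≃ₜ V))), ∀ x ∈ X, g x ∉ Y := by
  obtain ⟨f, hf⟩ := hMA.exists_forall_notMem
    (fun i : List (H × Bool) × X × Y => {f | evalWord h f i.2.1 i.1 = i.2.2})
    (fun i => isClosed_eq (continuous_evalWord h1 h2 _ _) continuous_const)
    (fun i => interior_evalWord_eq h1 h2 hAB hne hX hX' hY hXY i.2.1.2 _ i.2.2.2) (by
      simp only [mk_prod, lift_id]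
      have hl : #(List (H × Bool)) < 𝔠 := by
        refine (mk_list_le_max _).trans_lt (max_lt aleph0_lt_continuum ?_)
        rw [mk_prod, lift_id, lift_id]
        exact mul_lt_of_lt aleph0_le_continuum hH ((lt_aleph0_of_finite _).trans
          aleph0_lt_continuum)
      exact mul_lt_of_lt aleph0_le_continuum hl (mul_lt_of_lt aleph0_le_continuum hXc hYc))
  refine ⟨f, ?_⟩
  -- the points reached from `X` by words form a set invariant under the larger group
  let R : Set V := {z | ∃ (w : List (H × Bool)) (x : V), x ∈ X ∧ evalWord h f x w = z}
  have hRY : ∀ z ∈ R, z ∉ Y := by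
    rintro z ⟨w, x, hx, rfl⟩ hy
    exact hf (w, ⟨x, hx⟩, ⟨_, hy⟩) rfl
  have hRH : ∀ g ∈ H, ∀ z ∈ R, g z ∈ R := by
    rintro g hg z ⟨w, x, hx, rfl⟩
    rcases w with _ | ⟨⟨g', e⟩, w⟩
    · exact ⟨[], g x, hXH g hg x hx, rfl⟩
    · exact ⟨(⟨g, hg⟩ * g', e) :: w, x, hx, rfl⟩
  have hRh : ∀ e, ∀ z ∈ R, stepHomeo h f e z ∈ R := by
    rintro e z ⟨w, x, hx, rfl⟩
    exact ⟨(1, e) :: w, x, hx, rfl⟩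
  have key : ∀ g ∈ Subgroup.closure (insert (h f) (H : Set (V ≃ₜ V))), ∀ z ∈ R, g z ∈ R := by
    intro g hg
    induction hg using Subgroup.closure_induction'' with
    | one => exact fun z hz => hz
    | mem g hg =>
      rcases hg with rfl | hg
      · exact hRh true
      · exact hRH g hg
    | inv_mem g hg =>
      rcases hg with rfl | hg
      · exact hRh false
      · exact hRH _ (H.inv_mem hg)
    | mul g g' _ _ ih ih' => exact fun z hz => ih _ (ih' _ hz)
  exact fun g hg x hx => hRY _ (key g hg x ⟨[], x, hx, rfl⟩)

end Words

/-! ### Transfinite construction -/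

/-- A transfinite recursion of length `𝔠`: if each of at most `𝔠` many tasks can be accomplished at
any good stage that is the join of fewer than `𝔠` many increments, by one further increment, then a
single good element accomplishes all tasks. -/
theorem exists_forall_accomplished {L τ : Type} [CompleteLattice L] (hτ : #τ ≤ 𝔠) {good : L → Prop}
    {D : Set L} {done : τ → L → Prop}
    (hchain : ∀ c : Set L, IsChain (· ≤ ·) c → (∀ s ∈ c, good s) → good (sSup c))
    (hmono : ∀ t s s', s ≤ s' → done t s → done t s')
    (hext : ∀ t, ∀ S ⊆ D, #S < 𝔠 → good (sSup S) →
      ∃ d ∈ D, good (sSup S ⊔ d) ∧ done t (sSup S ⊔ d)) :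
    ∃ s, good s ∧ ∀ t, done t s := by
  classical
  rcases isEmpty_or_nonempty τ with hemp | hnon
  · exact ⟨sSup ∅, hchain ∅ (by simp) (by simp), fun t => hemp.elim t⟩
  let ι := (Cardinal.continuum.{0}).ord.ToType
  obtain ⟨e, he⟩ : ∃ e : ι → τ, Function.Surjective e := by
    have : #τ ≤ #ι := by rw [mk_ord_toType]; exact hτ
    obtain ⟨f⟩ := this
    exact ⟨_, Function.invFun_surjective f.injective⟩
  have hstep : ∀ (s : L) (t : τ), ∃ d, (∃ S ⊆ D, #S < 𝔠 ∧ sSup S = s) → good s →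
      d ∈ D ∧ good (s ⊔ d) ∧ done t (s ⊔ d) := by
    intro s t
    by_cases h : (∃ S ⊆ D, #S < 𝔠 ∧ sSup S = s) ∧ good s
    · obtain ⟨⟨S, hS, hc, rfl⟩, hg⟩ := h
      obtain ⟨d, hd⟩ := hext t S hS hc hg
      exact ⟨d, fun _ _ => hd⟩
    · exact ⟨⊥, fun h1 h2 => absurd ⟨h1, h2⟩ h⟩
  choose step hstep using hstep
  let d : ι → L := WellFoundedLT.fix fun i rec => step (⨆ j : Iio i, rec j j.2) (e i)
  have hd : ∀ i, d i = step (sSup (d '' Iio i)) (e i) := by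
    intro i
    rw [sSup_image']
    exact WellFoundedLT.fix_eq _ i
  let S : ι → L := fun i => sSup (d '' Iio i) ⊔ d i
  have hdS : ∀ i, d i ≤ S i := fun i => le_sup_right
  have hSd : ∀ i, S i = sSup (d '' Iic i) := fun i => by
    rw [← Iio_insert, image_insert_eq, sSup_insert, sup_comm]
  have hSmono : Monotone S := fun i j hij => by
    rw [hSd, hSd]; exact sSup_le_sSup (image_mono (Iic_subset_Iic.2 hij))
  have hlow : ∀ i, sSup (d '' Iio i) = sSup (S '' Iio i) := fun i => by
    apply le_antisymm
    · refine sSup_le ?_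
      rintro _ ⟨j, hj, rfl⟩
      exact (hdS j).trans (le_sSup ⟨j, hj, rfl⟩)
    · refine sSup_le ?_
      rintro _ ⟨j, hj, rfl⟩
      rw [hSd]
      exact sSup_le_sSup (image_mono fun k hk => (mem_Iic.1 hk).trans_lt hj)
  have hch : ∀ T : Set ι, IsChain (· ≤ ·) (S '' T) := by
    rintro T _ ⟨i, -, rfl⟩ _ ⟨j, -, rfl⟩ -
    exact (le_total i j).imp (fun h => hSmono h) (fun h => hSmono h)
  have key : ∀ i, d i ∈ D ∧ good (S i) ∧ done (e i) (S i) := by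
    intro i
    induction i using WellFoundedLT.induction with
    | _ i ih =>
    have h1 : good (sSup (d '' Iio i)) := by
      rw [hlow]
      refine hchain _ (hch _) ?_
      rintro _ ⟨j, hj, rfl⟩
      exact (ih j hj).2.1
    have h2 : d '' Iio i ⊆ D := by
      rintro _ ⟨j, hj, rfl⟩
      exact (ih j hj).1
    have h3 : #(d '' Iio i) < 𝔠 := by
      have := mk_Iio_lt i (by rw [mk_ord_toType, Ordinal.type_toType])
      rw [mk_ord_toType] at this
      exact mk_image_le.trans_lt this
    have := hstep (sSup (d '' Iio i)) (e i) ⟨_, h2, h3, rfl⟩ h1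
    rwa [← hd] at this
  refine ⟨sSup (S '' univ), hchain _ (hch _) ?_, fun t => ?_⟩
  · rintro _ ⟨i, -, rfl⟩
    exact (key i).2.1
  · obtain ⟨i, rfl⟩ := he t
    exact hmono _ _ _ (le_sSup ⟨i, mem_univ _, rfl⟩) (key i).2.2

/-! ### Stages of the construction -/

/-- The translations by finitely supported sequences. -/
def finTranslations : Set ((ℕ → ZMod 3) ≃ₜ (ℕ → ZMod 3)) :=
  range fun t : ℕ →₀ ZMod 3 => Homeomorph.addRight (⇑t)

/-- The group generated by `K` and the translations by finitely supported sequences. -/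
def stageGroup (K : Set ((ℕ → ZMod 3) ≃ₜ (ℕ → ZMod 3))) : Subgroup ((ℕ → ZMod 3) ≃ₜ (ℕ → ZMod 3)) :=
  Subgroup.closure (finTranslations ∪ K)

/-- The union of the orbits of the points of `E` under `stageGroup K`. -/
def hull (K : Set ((ℕ → ZMod 3) ≃ₜ (ℕ → ZMod 3))) (E : Set (ℕ → ZMod 3)) : Set (ℕ → ZMod 3) :=
  {x | ∃ g ∈ stageGroup K, ∃ e ∈ E, g e = x}

variable {K K' : Set ((ℕ → ZMod 3) ≃ₜ (ℕ → ZMod 3))} {E E' F F' : Set (ℕ → ZMod 3)}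

theorem stageGroup_mono (hK : K ⊆ K') : stageGroup K ≤ stageGroup K' :=
  Subgroup.closure_mono (union_subset_union_right _ hK)

theorem hull_mono (hK : K ⊆ K') (hE : E ⊆ E') : hull K E ⊆ hull K' E' := by
  rintro x ⟨g, hg, e, he, rfl⟩
  exact ⟨g, stageGroup_mono hK hg, e, hE he, rfl⟩

theorem subset_hull : E ⊆ hull K E := fun e he => ⟨1, one_mem _, e, he, rfl⟩

theorem apply_mem_hull {g : (ℕ → ZMod 3) ≃ₜ (ℕ → ZMod 3)} (hg : g ∈ stageGroup K)
    {x : ℕ → ZMod 3} : g x ∈ hull K E ↔ x ∈ hull K E := by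
  constructor
  · rintro ⟨g', hg', e, he, h⟩
    refine ⟨g⁻¹ * g', mul_mem (inv_mem hg) hg', e, he, ?_⟩
    rw [Homeomorph.mul_apply, h, ← Homeomorph.mul_apply, inv_mul_cancel, Homeomorph.one_apply]
  · rintro ⟨g', hg', e, he, rfl⟩
    exact ⟨g * g', mul_mem hg hg', e, he, rfl⟩

theorem disjoint_hull_iff : Disjoint (hull K E) (hull K F) ↔ Disjoint E (hull K F) := by
  refine ⟨fun h => h.mono_left subset_hull, fun h => disjoint_left.2 ?_⟩
  rintro _ ⟨g, hg, e, he, rfl⟩ hf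
  exact disjoint_left.1 h he ((apply_mem_hull hg).1 hf)

theorem mk_stageGroup_lt (hK : #K < 𝔠) : #(stageGroup K) < 𝔠 := by
  refine mk_subgroup_closure_lt aleph0_lt_continuum ((mk_union_le _ _).trans_lt ?_)
  refine add_lt_of_lt aleph0_le_continuum ?_ hK
  exact (le_aleph0_iff_set_countable.2 (countable_range _)).trans_lt aleph0_lt_continuum

theorem mk_hull_lt (hK : #K < 𝔠) (hE : #E < 𝔠) : #(hull K E) < 𝔠 := by
  have : hull K E ⊆ range fun p : stageGroup K × E =>
      (p.1 : (ℕ → ZMod 3) ≃ₜ _) (p.2 : ℕ → ZMod 3) := by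
    rintro _ ⟨g, hg, e, he, rfl⟩
    exact ⟨(⟨g, hg⟩, ⟨e, he⟩), rfl⟩
  refine ((mk_le_mk_of_subset this).trans mk_range_le).trans_lt ?_
  rw [mk_prod, lift_id, lift_id]
  exact mul_lt_of_lt aleph0_le_continuum (mk_stageGroup_lt hK) hE

instance neBot_nhdsNE_ternary (x : ℕ → ZMod 3) : (𝓝[≠] x).NeBot := by
  have h : Tendsto (fun n : ℕ => x + Pi.single n 1) atTop (𝓝[≠] x) := by
    refine tendsto_nhdsWithin_iff.2 ⟨tendsto_pi_nhds.2 fun i => ?_,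
      Eventually.of_forall fun n h => ?_⟩
    · refine tendsto_const_nhds.congr' ?_
      filter_upwards [eventually_gt_atTop i] with n hn
      simp [hn.ne]
    · have := congrFun h n
      simp at this
  exact h.neBot

theorem dense_finTranslates (x : ℕ → ZMod 3) : DenseRange fun t : ℕ →₀ ZMod 3 => x + ⇑t := by
  intro v
  have h : Tendsto (fun n : ℕ => x + ⇑(Finsupp.onFinset (Finset.range n)
      (fun i => if i < n then v i - x i else 0) (by simp +contextual))) atTop (𝓝 v) := by
    refine tendsto_pi_nhds.2 fun i => tendsto_const_nhds.congr' ?_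
    filter_upwards [eventually_gt_atTop i] with n hn
    simp [hn]
  exact mem_closure_of_tendsto h (Eventually.of_forall fun n => mem_range_self _)

/-- The tasks of the construction: pairs of sequences, of which the first is to be mapped onto the
second; Borel sets, which are to be met; and sequences in `V × V × V`, whose closures stand for
the continuous functions of two variables that are to be excluded. -/
abbrev ConstructionTask : Type := ((ℕ → ℕ → ZMod 3) × (ℕ → ℕ → ZMod 3)) ⊕
  {P : Set (ℕ → ZMod 3) // @MeasurableSet _ (borel (ℕ → ZMod 3)) P} ⊕
  (ℕ → (ℕ → ZMod 3) × (ℕ → ZMod 3) × (ℕ → ZMod 3))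

theorem mk_task_le : #ConstructionTask ≤ 𝔠 := by
  have hV : #(ℕ → ZMod 3) = 𝔠 := by
    have h3 : #(ZMod 3) = 3 := by
      simp [Cardinal.mk_fintype, ZMod.card]
    rw [← power_def, h3, mk_nat]
    exact nat_power_aleph0 (n := 3) (by norm_num)
  have hseq : #(ℕ → ℕ → ZMod 3) = 𝔠 := by
    rw [← power_def, hV, mk_nat, continuum_power_aleph0]
  have hB : #{P : Set (ℕ → ZMod 3) // @MeasurableSet _ (borel (ℕ → ZMod 3)) P} ≤ 𝔠 := by
    rw [(TopologicalSpace.isBasis_countableBasis (ℕ → ZMod 3)).borel_eq_generateFrom]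
    exact MeasurableSpace.cardinal_measurableSet_le_continuum
      ((TopologicalSpace.countable_countableBasis _).le_aleph0.trans aleph0_le_continuum)
  have hC : #(ℕ → (ℕ → ZMod 3) × (ℕ → ZMod 3) × (ℕ → ZMod 3)) = 𝔠 := by
    rw [← power_def, mk_prod, mk_prod]
    simp only [lift_id]
    rw [hV, continuum_mul_self, continuum_mul_self, mk_nat, continuum_power_aleph0]
  rw [mk_sum, mk_sum, mk_prod]
  simp only [lift_id]
  rw [hseq, hC, continuum_mul_self]
  exact add_le_of_le aleph0_le_continuum le_rfl (add_le_of_le aleph0_le_continuum hB le_rfl)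

/-- What the points of `hull K E`, the points of `hull K F` and the group `stageGroup K` have to
satisfy for a task to be accomplished. The target space will contain the former points, miss the
latter, and be invariant under the group. -/
def Accomplished (K : Set ((ℕ → ZMod 3) ≃ₜ (ℕ → ZMod 3))) (E F : Set (ℕ → ZMod 3)) :
    ConstructionTask → Prop
  | .inl (a, b) => DenseRange a → DenseRange b → (∃ x ∈ range a ∪ range b, x ∈ hull K F) ∨
      ∃ h ∈ stageGroup K, ∀ x, h x ∈ range b ↔ x ∈ range a
  | .inr (.inl P) => #P.1 = 𝔠 → (P.1 ∩ hull K E).Nonempty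
  | .inr (.inr c) => (∀ x y, ∃ v, (x, y, v) ∈ closure (range c)) →
      (∃ u : (ℕ → ZMod 3) → ℕ → ZMod 3,
        (interior {z : (ℕ → ZMod 3) × (ℕ → ZMod 3) |
          (z.1, z.2, u z.1) ∈ closure (range c)}).Nonempty ∨
        (interior {z : (ℕ → ZMod 3) × (ℕ → ZMod 3) |
          (z.1, z.2, u z.2) ∈ closure (range c)}).Nonempty) ∨
      ∃ x ∈ hull K E, ∃ y ∈ hull K E, ∃ v ∈ hull K F, (x, y, v) ∈ closure (range c)

theorem Accomplished.mono (hK : K ⊆ K') (hE : E ⊆ E') (hF : F ⊆ F') {t : ConstructionTask}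
    (h : Accomplished K E F t) : Accomplished K' E' F' t := by
  rcases t with ⟨a, b⟩ | P | c
  · intro ha hb
    rcases h ha hb with ⟨x, hx, hx'⟩ | ⟨g, hg, hg'⟩
    · exact Or.inl ⟨x, hx, hull_mono hK hF hx'⟩
    · exact Or.inr ⟨g, stageGroup_mono hK hg, hg'⟩
  · intro hP
    exact (h hP).mono (inter_subset_inter_right _ (hull_mono hK hE))
  · intro hc
    rcases h hc with h | ⟨x, hx, y, hy, v, hv, hm⟩
    · exact Or.inl h
    · exact Or.inr ⟨x, hull_mono hK hE hx, y, hull_mono hK hE hy, v, hull_mono hK hF hv, hm⟩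

theorem hull_union : hull K (E ∪ E') = hull K E ∪ hull K E' := by
  ext x
  simp only [hull, mem_union, mem_ofPred_eq]
  grind

/-- A homeomorphism that maps `range a` onto `range b` can be adjoined to `K`, provided that no
orbit of a point of `F` meets these two sets. -/
theorem MASigmaCentered.exists_map_increment (hMA : MASigmaCentered) (hK : #K < 𝔠) (hE : #E < 𝔠)
    (hF : #F < 𝔠) (hEF : Disjoint (hull K E) (hull K F)) {a b : ℕ → ℕ → ZMod 3}
    (ha : DenseRange a) (hb : DenseRange b) (hab : Disjoint (range a ∪ range b) (hull K F)) :
    ∃ h, Disjoint (hull (insert h K) E) (hull (insert h K) F) ∧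
      ∀ x, h x ∈ range b ↔ x ∈ range a := by
  have hctb : #(range a ∪ range b : Set (ℕ → ZMod 3)) < 𝔠 :=
    (le_aleph0_iff_set_countable.2 ((countable_range _).union (countable_range _))).trans_lt
      aleph0_lt_continuum
  have hsub : range a ∪ range b ⊆ hull K (E ∪ (range a ∪ range b)) :=
    subset_union_right.trans subset_hull
  obtain ⟨f, hf⟩ := hMA.exists_forall_closure_insert (H := stageGroup K) (A := range a)
    (B := range b) (X := hull K (E ∪ (range a ∪ range b))) (Y := hull K F)
    (continuous_transfer a b) (continuous_transfer_symm a b) (transfer_mem_range ha hb)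
    (fun f O hO hf c hc S hS hcS => exists_transfer_ne ha hO hf hc hS hcS)
    (subset_union_left.trans hsub) (subset_union_right.trans hsub)
    (fun g hg x hx => (apply_mem_hull hg).2 hx) (fun g hg x hx => (apply_mem_hull hg).2 hx)
    (by
      rw [hull_union, disjoint_union_left]
      exact ⟨hEF, disjoint_hull_iff.2 hab⟩)
    (mk_stageGroup_lt hK)
    (mk_hull_lt hK ((mk_union_le _ _).trans_lt (add_lt_of_lt aleph0_le_continuum hE hctb)))
    (mk_hull_lt hK hF)
  have hle : stageGroup (insert (transfer a b f) K) ≤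
      Subgroup.closure (insert (transfer a b f) (stageGroup K)) := by
    refine (Subgroup.closure_le _).2 ?_
    rintro g (hg | rfl | hg)
    · exact Subgroup.subset_closure (Or.inr (Subgroup.subset_closure (Or.inl hg)))
    · exact Subgroup.subset_closure (Or.inl rfl)
    · exact Subgroup.subset_closure (Or.inr (Subgroup.subset_closure (Or.inr hg)))
  refine ⟨transfer a b f, disjoint_comm.1 (disjoint_hull_iff.2 (disjoint_left.2 ?_)),
    transfer_mem_range ha hb f⟩
  rintro _ hy ⟨g, hg, e, he, rfl⟩
  exact hf g (hle hg) e (subset_hull (Or.inl he)) (subset_hull hy)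

theorem exists_point_increment (hK : #K < 𝔠) (hF : #F < 𝔠)
    (hEF : Disjoint (hull K E) (hull K F)) {P : Set (ℕ → ZMod 3)} (hP : #P = 𝔠) :
    ∃ x ∈ P, Disjoint (hull K (E ∪ {x})) (hull K F) := by
  obtain ⟨x, hxP, hx⟩ := sdiff_nonempty_of_mk_lt_mk ((mk_hull_lt hK hF).trans_eq hP.symm)
  refine ⟨x, hxP, ?_⟩
  rw [hull_union, disjoint_union_left]
  exact ⟨hEF, disjoint_hull_iff.2 (disjoint_singleton_left.2 hx)⟩

/-- A generic pair `(x, y)` and any `v` over it in the closed relation `C`: if `v` were in the orbit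
of `x`, of `y` or of a point of `E`, then `C` would contain a piece of the graph of a function of
one variable. -/
theorem MASigmaCentered.exists_pair_increment (hMA : MASigmaCentered) (hK : #K < 𝔠) (hE : #E < 𝔠)
    (hF : #F < 𝔠) (hEF : Disjoint (hull K E) (hull K F))
    {C : Set ((ℕ → ZMod 3) × (ℕ → ZMod 3) × (ℕ → ZMod 3))} (hC : IsClosed C)
    (htotal : ∀ x y, ∃ v, (x, y, v) ∈ C)
    (hfst : ∀ u : (ℕ → ZMod 3) → ℕ → ZMod 3,
      interior {z : (ℕ → ZMod 3) × (ℕ → ZMod 3) | (z.1, z.2, u z.1) ∈ C} = ∅)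
    (hsnd : ∀ u : (ℕ → ZMod 3) → ℕ → ZMod 3,
      interior {z : (ℕ → ZMod 3) × (ℕ → ZMod 3) | (z.1, z.2, u z.2) ∈ C} = ∅) :
    ∃ x y v, (x, y, v) ∈ C ∧ Disjoint (hull K (E ∪ {x, y})) (hull K (F ∪ {v})) := by
  let N : (stageGroup K ⊕ stageGroup K) ⊕ (hull K E ⊕ (hull K F ⊕ hull K F)) →
      Set ((ℕ → ZMod 3) × (ℕ → ZMod 3)) := Sum.elim
    (Sum.elim (fun h => {z | (z.1, z.2, (h : (ℕ → ZMod 3) ≃ₜ _) z.1) ∈ C})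
      (fun h => {z | (z.1, z.2, (h : (ℕ → ZMod 3) ≃ₜ _) z.2) ∈ C}))
    (Sum.elim (fun v => {z | (z.1, z.2, (v : ℕ → ZMod 3)) ∈ C})
      (Sum.elim (fun y => {(y : ℕ → ZMod 3)} ×ˢ Set.univ)
        (fun y => Set.univ ×ˢ {(y : ℕ → ZMod 3)})))
  obtain ⟨⟨x, y⟩, hxy⟩ := hMA.exists_forall_notMem N
    (by
      rintro ((h | h) | v | y | y)
      · exact hC.preimage (continuous_fst.prodMk (continuous_snd.prodMk
          ((h : (ℕ → ZMod 3) ≃ₜ (ℕ → ZMod 3)).continuous.comp continuous_fst)))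
      · exact hC.preimage (continuous_fst.prodMk (continuous_snd.prodMk
          ((h : (ℕ → ZMod 3) ≃ₜ (ℕ → ZMod 3)).continuous.comp continuous_snd)))
      · exact hC.preimage (continuous_fst.prodMk (continuous_snd.prodMk continuous_const))
      · exact isClosed_singleton.prod isClosed_univ
      · exact isClosed_univ.prod isClosed_singleton)
    (by
      rintro ((h | h) | v | y | y)
      · exact hfst h
      · exact hsnd h
      · exact hfst fun _ => v
      · simp [N, interior_prod_eq]
      · simp [N, interior_prod_eq])
    (by
      have hG := mk_stageGroup_lt hK
      have hE' := mk_hull_lt hK hE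
      have hF' := mk_hull_lt hK hF
      simp only [mk_sum, lift_id]
      have hadd : ∀ {κ μ : Cardinal.{0}}, κ < 𝔠 → μ < 𝔠 → κ + μ < 𝔠 := fun h h' =>
        add_lt_of_lt aleph0_le_continuum h h'
      exact hadd (hadd hG hG) (hadd hE' (hadd hF' hF')))
  obtain ⟨v, hv⟩ := htotal x y
  refine ⟨x, y, v, hv, ?_⟩
  have hx : x ∉ hull K F := fun h => hxy (.inr (.inr (.inl ⟨x, h⟩))) (by simp [N])
  have hy : y ∉ hull K F := fun h => hxy (.inr (.inr (.inr ⟨y, h⟩))) (by simp [N])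
  have hvE : v ∉ hull K E := fun h => hxy (.inr (.inl ⟨v, h⟩)) hv
  have hvxy : v ∉ hull K {x, y} := by
    rintro ⟨g, hg, e, rfl | rfl, rfl⟩
    · exact hxy (.inl (.inl ⟨g, hg⟩)) hv
    · exact hxy (.inl (.inr ⟨g, hg⟩)) hv
  rw [hull_union, hull_union, disjoint_union_left, disjoint_union_right, disjoint_union_right]
  refine ⟨⟨hEF, ?_⟩, disjoint_hull_iff.2 ?_, ?_⟩
  · exact disjoint_comm.1 (disjoint_hull_iff.2 (disjoint_singleton_left.2 hvE))
  · simp [hx, hy]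
  · exact disjoint_comm.1 (disjoint_hull_iff.2 (disjoint_singleton_left.2 hvxy))

/-- The outcome of the transfinite construction: `hull K E` is the space sought. -/
theorem MASigmaCentered.exists_forall_accomplished (hMA : MASigmaCentered) :
    ∃ (K : Set ((ℕ → ZMod 3) ≃ₜ (ℕ → ZMod 3))) (E F : Set (ℕ → ZMod 3)),
      Disjoint (hull K E) (hull K F) ∧ ∀ t, Accomplished K E F t := by
  classical
  obtain ⟨⟨K, E, F⟩, h1, h2⟩ := _root_.exists_forall_accomplished
    (L := Set ((ℕ → ZMod 3) ≃ₜ (ℕ → ZMod 3)) × Set (ℕ → ZMod 3) × Set (ℕ → ZMod 3))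
    (τ := ConstructionTask) mk_task_le
    (good := fun s => Disjoint (hull s.1 s.2.1) (hull s.1 s.2.2))
    (D := {d | d.1.Countable ∧ d.2.1.Countable ∧ d.2.2.Countable})
    (done := fun t s => Accomplished s.1 s.2.1 s.2.2 t)
    (by
      intro c hc hgood
      refine disjoint_hull_iff.2 (disjoint_left.2 ?_)
      rintro e he ⟨g, hg, f, hf, hgf⟩
      simp only [Prod.fst_sSup, Prod.snd_sSup, sSup_eq_sUnion, sUnion_image, mem_iUnion] at he hf hg
      obtain ⟨_, ⟨s, hs, rfl⟩, he⟩ := he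
      obtain ⟨_, ⟨s', hs', rfl⟩, hf⟩ := hf
      have hg' : ∃ s ∈ c, g ∈ stageGroup s.1 := by
        clear hgf
        induction hg using Subgroup.closure_induction with
        | mem g hg =>
          rcases hg with hg | hg
          · exact ⟨s, hs, Subgroup.subset_closure (Or.inl hg)⟩
          · obtain ⟨r, hr, hg⟩ := mem_iUnion₂.1 hg
            exact ⟨r, hr, Subgroup.subset_closure (Or.inr hg)⟩
        | one => exact ⟨s, hs, one_mem _⟩
        | mul g g' _ _ ih ih' =>
          obtain ⟨r, hr, hg⟩ := ih
          obtain ⟨r', hr', hg'⟩ := ih'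
          obtain ⟨q, hq, hrq, hrq'⟩ := hc.directedOn r hr r' hr'
          exact ⟨q, hq, mul_mem (stageGroup_mono hrq.1 hg) (stageGroup_mono hrq'.1 hg')⟩
        | inv g _ ih =>
          obtain ⟨r, hr, hg⟩ := ih
          exact ⟨r, hr, inv_mem hg⟩
      obtain ⟨r, hr, hgr⟩ := hg'
      obtain ⟨p, hp, hsp, hsp'⟩ := hc.directedOn s hs s' hs'
      obtain ⟨q, hq, hpq, hrq⟩ := hc.directedOn p hp r hr
      exact disjoint_left.1 (disjoint_hull_iff.1 (hgood q hq)) ((hsp.trans hpq).2.1 he)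
        ⟨g, stageGroup_mono hrq.1 hgr, f, (hsp'.trans hpq).2.2 hf, hgf⟩)
    (fun t s s' hs => by
      obtain ⟨hK, hE, hF⟩ := hs
      exact Accomplished.mono hK hE hF)
    (by
      intro t S hS hSc hgood
      have hsmall : ∀ {α : Type} (A : Set ((ℕ → ZMod 3) ≃ₜ (ℕ → ZMod 3)) × Set (ℕ → ZMod 3) ×
          Set (ℕ → ZMod 3) → Set α), (∀ s ∈ S, (A s).Countable) → #(⋃ s ∈ S, A s) < 𝔠 := by
        intro α A hA
        refine (mk_biUnion_le A S).trans_lt (mul_lt_of_lt aleph0_le_continuum hSc ?_)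
        exact (ciSup_le' fun s : S => le_aleph0_iff_set_countable.2 (hA s s.2)).trans_lt
          aleph0_lt_continuum
      have hK : #(sSup S).1 < 𝔠 := by
        simpa only [Prod.fst_sSup, sSup_eq_sUnion, sUnion_image] using
          hsmall (fun s => s.1) fun s hs => (hS hs).1
      have hE : #(sSup S).2.1 < 𝔠 := by
        simpa only [Prod.fst_sSup, Prod.snd_sSup, sSup_eq_sUnion, sUnion_image, image_image] using
          hsmall (fun s => s.2.1) fun s hs => (hS hs).2.1
      have hF : #(sSup S).2.2 < 𝔠 := by
        simpa only [Prod.fst_sSup, Prod.snd_sSup, sSup_eq_sUnion, sUnion_image, image_image] using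
          hsmall (fun s => s.2.2) fun s hs => (hS hs).2.2
      generalize sSup S = s at *
      obtain ⟨K, E, F⟩ := s
      simp only [mem_ofPred_eq] at *
      have hbot : Accomplished K E F t → ∃ d : Set ((ℕ → ZMod 3) ≃ₜ (ℕ → ZMod 3)) ×
          Set (ℕ → ZMod 3) × Set (ℕ → ZMod 3),
          (d.1.Countable ∧ d.2.1.Countable ∧ d.2.2.Countable) ∧
          Disjoint (hull (K ∪ d.1) (E ∪ d.2.1)) (hull (K ∪ d.1) (F ∪ d.2.2)) ∧
          Accomplished (K ∪ d.1) (E ∪ d.2.1) (F ∪ d.2.2) t := fun h =>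
        ⟨(∅, ∅, ∅), by simp, by simpa using hgood, by simpa using h⟩
      rcases t with ⟨a, b⟩ | P | c
      · by_cases hab : DenseRange a ∧ DenseRange b ∧ Disjoint (range a ∪ range b) (hull K F)
        · obtain ⟨h, h1, h2⟩ := hMA.exists_map_increment hK hE hF hgood hab.1 hab.2.1 hab.2.2
          refine ⟨({h}, ∅, ∅), by simp, by simpa using h1, fun _ _ => Or.inr ⟨h, ?_, h2⟩⟩
          exact Subgroup.subset_closure (Or.inr (Or.inr rfl))
        · refine hbot fun ha hb => Or.inl ?_
          exact not_disjoint_iff.1 fun h => hab ⟨ha, hb, h⟩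
      · by_cases hP : #P.1 = 𝔠
        · obtain ⟨x, hx, h1⟩ := exists_point_increment hK hF hgood hP
          refine ⟨(∅, {x}, ∅), by simp, by simpa using h1, fun _ => ⟨x, hx, ?_⟩⟩
          exact subset_hull (Or.inr rfl)
        · exact hbot fun h => absurd h hP
      · by_cases hu : (∀ x y, ∃ v, (x, y, v) ∈ closure (range c)) ∧
            ∀ u : (ℕ → ZMod 3) → ℕ → ZMod 3,
              interior {z : (ℕ → ZMod 3) × (ℕ → ZMod 3) |
                (z.1, z.2, u z.1) ∈ closure (range c)} = ∅ ∧
              interior {z : (ℕ → ZMod 3) × (ℕ → ZMod 3) |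
                (z.1, z.2, u z.2) ∈ closure (range c)} = ∅
        · obtain ⟨x, y, v, h1, h2⟩ := hMA.exists_pair_increment hK hE hF hgood isClosed_closure
            hu.1 (fun u => (hu.2 u).1) (fun u => (hu.2 u).2)
          refine ⟨(∅, {x, y}, {v}), by simp, by simpa using h2, fun _ => Or.inr ⟨x, ?_, y, ?_, v,
            ?_, h1⟩⟩
          · exact subset_hull (Or.inr (Or.inl rfl))
          · exact subset_hull (Or.inr (Or.inr rfl))
          · exact subset_hull (Or.inr rfl)
        · refine hbot fun ht => Or.inl ?_
          by_contra! hne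
          refine hu ⟨ht, fun u => ?_⟩
          exact hne u)
  exact ⟨K, E, F, h1, h2⟩

/-! ### General facts on the three properties of spaces -/

section General

variable {X Y : Type*} [TopologicalSpace X] [TopologicalSpace Y]

theorem IsCountableDenseHomogeneous.of_homeomorph (e : X ≃ₜ Y) (h : IsCountableDenseHomogeneous X) :
    IsCountableDenseHomogeneous Y := by
  intro A B hA hA' hB hB'
  obtain ⟨g, hg⟩ := h (e.symm '' A) (e.symm '' B) (hA.image _)
    (e.symm.surjective.denseRange.dense_image e.symm.continuous hA') (hB.image _)
    (e.symm.surjective.denseRange.dense_image e.symm.continuous hB')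
  refine ⟨(e.symm.trans g).trans e, ?_⟩
  have : ⇑((e.symm.trans g).trans e) '' A = e '' (g '' (e.symm '' A)) := by
    simp only [image_image]; rfl
  rw [this, hg, image_image]
  simp

theorem IsHomogeneousSpace.of_homeomorph (e : X ≃ₜ Y) (h : IsHomogeneousSpace X) :
    IsHomogeneousSpace Y := by
  intro x y
  obtain ⟨g, hg⟩ := h (e.symm x) (e.symm y)
  exact ⟨(e.symm.trans g).trans e, by simp [hg]⟩

theorem IsCompletelyBaire.of_homeomorph (e : X ≃ₜ Y) (h : IsCompletelyBaire X) :
    IsCompletelyBaire Y := by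
  intro C hC
  have := h (e.symm '' C) (e.symm.isClosedMap _ hC)
  exact (e.symm.image C).symm.baireSpace

/-- If the orbit of `x` had empty interior, then a countable dense set disjoint from the orbit could
not be mapped to the same set with `x` added. -/
theorem IsCountableDenseHomogeneous.isOpen_orbit [SecondCountableTopology X]
    (h : IsCountableDenseHomogeneous X) (x : X) : IsOpen {y | ∃ g : X ≃ₜ X, g x = y} := by
  set O := {y | ∃ g : X ≃ₜ X, g x = y} with hO
  have hint : (interior O).Nonempty := by
    by_contra hne
    rw [not_nonempty_iff_eq_empty, interior_eq_empty_iff_dense_compl] at hne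
    obtain ⟨D, hDO, hDc, hD⟩ := hne.exists_countable_dense_subset
    obtain ⟨g, hg⟩ := h D (insert x D) hDc hD (hDc.insert x) (hD.mono (subset_insert _ _))
    obtain ⟨d, hd, hdx⟩ : x ∈ g '' D := hg ▸ mem_insert _ _
    exact hDO hd ⟨g.symm, by rw [← hdx, g.symm_apply_apply]⟩
  obtain ⟨z, hz⟩ := hint
  refine isOpen_iff_mem_nhds.2 ?_
  rintro _ ⟨g, rfl⟩
  obtain ⟨g', hg'⟩ := interior_subset hz
  have hk : IsOpen (g '' (g'.symm '' interior O)) :=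
    g.isOpenMap _ (g'.symm.isOpenMap _ isOpen_interior)
  refine mem_of_superset (hk.mem_nhds ⟨x, ⟨z, hz, ?_⟩, rfl⟩) ?_
  · rw [← hg', g'.symm_apply_apply]
  · rintro _ ⟨_, ⟨w, hw, rfl⟩, rfl⟩
    obtain ⟨k, hk⟩ := interior_subset hw
    exact ⟨(k.trans g'.symm).trans g, by simp [hk]⟩

/-- A space without isolated points has a countable dense set in its square no two
points of which have the same first coordinate. -/
theorem exists_countable_dense_injOn_fst (X : Type*) [TopologicalSpace X] [T1Space X]
    [SecondCountableTopology X] [Nonempty X] [∀ x : X, (𝓝[≠] x).NeBot] :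
    ∃ D : Set (X × X), D.Countable ∧ Dense D ∧ InjOn Prod.fst D := by
  classical
  have hbasis := TopologicalSpace.isBasis_countableBasis (X × X)
  obtain ⟨b, hb⟩ := (TopologicalSpace.countable_countableBasis (X × X)).exists_eq_range
    (by
      obtain ⟨p⟩ := (inferInstance : Nonempty (X × X))
      obtain ⟨U, hU, -⟩ := hbasis.mem_nhds_iff.1 (univ_mem (f := 𝓝 p))
      exact ⟨U, hU⟩)
  have hbmem : ∀ n, b n ∈ TopologicalSpace.countableBasis (X × X) := fun n =>
    hb ▸ mem_range_self n
  have hinf : ∀ n, (Prod.fst '' b n).Infinite := by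
    intro n
    obtain ⟨p, hp⟩ := TopologicalSpace.nonempty_of_mem_countableBasis (hbmem n)
    exact infinite_of_mem_nhds p.1 ((isOpenMap_fst _
      (TopologicalSpace.isOpen_of_mem_countableBasis (hbmem n))).mem_nhds ⟨p, hp, rfl⟩)
  choose T hT hTcard using fun n => (hinf n).exists_subset_card_eq (n + 1)
  -- Hall's condition holds as the union over a set of indices has more elements than its maximum
  obtain ⟨x, hx, hxT⟩ := (Finset.all_card_le_biUnion_card_iff_exists_injective T).1 (by
    intro s
    rcases s.eq_empty_or_nonempty with rfl | hs
    · simp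
    · calc s.card ≤ (Finset.range (s.max' hs + 1)).card :=
            Finset.card_le_card fun i hi => Finset.mem_range.2 (Nat.lt_succ_of_le (s.le_max' i hi))
        _ = (T (s.max' hs)).card := by simp [hTcard]
        _ ≤ _ := Finset.card_le_card (Finset.subset_biUnion_of_mem T (s.max'_mem hs)))
  choose p hp hpx using fun n => hT n (hxT n)
  refine ⟨range p, countable_range _, ?_, ?_⟩
  · refine hbasis.dense_iff.2 fun U hU _ => ?_
    rw [hb] at hU
    obtain ⟨n, rfl⟩ := hU
    exact ⟨p n, hp n, mem_range_self n⟩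
  · rintro _ ⟨n, rfl⟩ _ ⟨m, rfl⟩ h
    rw [hpx, hpx] at h
    rw [hx h]

/-- Let `C` be embedded in a compact space so that it meets each uncountable Borel subset of its
closure. A countable intersection of dense open sets of `C` extends to one in the closure of `C`;
in an open set without isolated points of that closure the extension is uncountable. -/
theorem Topology.IsInducing.baireSpace_of_inter_nonempty {C V : Type*} [TopologicalSpace C]
    [TopologicalSpace V] [CompactSpace V] [T2Space V] {j : C → V} (hj : IsInducing j)
    (hji : Function.Injective j)
    (hmeet : ∀ G : Set V, @MeasurableSet _ (borel V) G → ¬ G.Countable → G ⊆ closure (range j) →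
      (G ∩ range j).Nonempty) : BaireSpace C := by
  refine ⟨fun f hfo hfd => dense_iff_inter_open.2 fun U hU hUne => ?_⟩
  choose O hO hOf using fun n => hj.isOpen_iff.1 (hfo n)
  obtain ⟨U', hU', rfl⟩ := hj.isOpen_iff.1 hU
  set Z := closure (range j) with hZ
  by_cases hiso : ∃ p ∈ Z ∩ U', ∃ W, IsOpen W ∧ p ∈ W ∧ W ∩ Z ⊆ {p}
  · obtain ⟨p, ⟨hpZ, hpU⟩, W, hW, hpW, hWZ⟩ := hiso
    have hcp : ∀ c, j c ∈ W → j c = p := fun c hc => hWZ ⟨hc, subset_closure (mem_range_self c)⟩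
    obtain ⟨_, hcW, c, rfl⟩ := mem_closure_iff.1 hpZ W hW hpW
    refine ⟨c, by rw [mem_preimage, hcp c hcW]; exact hpU, mem_iInter.2 fun n => ?_⟩
    obtain ⟨d, hdW, hd⟩ := (hfd n).inter_open_nonempty (j ⁻¹' W)
      (hW.preimage hj.continuous) ⟨c, hcW⟩
    rwa [hji ((hcp c hcW).trans (hcp d hdW).symm)]
  · let G := (Z ∩ U') ∩ ⋂ n, O n
    by_cases hG : G.Countable
    · exfalso
      have : CompactSpace Z := isCompact_iff_compactSpace.1 isClosed_closure.isCompact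
      have := hG.to_subtype
      let D : ℕ ⊕ G → Set Z := Sum.elim (fun n => (↑) ⁻¹' O n) (fun g => (↑) ⁻¹' {(g : V)}ᶜ)
      have hD : Dense (⋂ i, D i) := by
        refine dense_iInter_of_isOpen ?_ ?_
        · rintro (n | g)
          · exact (hO n).preimage continuous_subtype_val
          · exact isClosed_singleton.isOpen_compl.preimage continuous_subtype_val
        · rintro (n | g) <;> refine dense_iff_inter_open.2 ?_
          · rintro _ ⟨W, hW, rfl⟩ ⟨z, hz⟩
            obtain ⟨_, hcW, c, rfl⟩ := mem_closure_iff.1 z.2 W hW hz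
            obtain ⟨d, hdW, hd⟩ := (hfd n).inter_open_nonempty (j ⁻¹' W)
              (hW.preimage hj.continuous) ⟨c, hcW⟩
            rw [← hOf] at hd
            exact ⟨⟨j d, subset_closure (mem_range_self d)⟩, hdW, hd⟩
          · rintro _ ⟨W, hW, rfl⟩ ⟨z, hz⟩
            by_contra hne
            have hsub : W ∩ Z ⊆ {(g : V)} := fun w hw => by
              by_contra hwg
              exact hne ⟨⟨w, hw.2⟩, hw.1, hwg⟩
            refine hiso ⟨g, g.2.1, W, hW, ?_, hsub⟩
            have : (z : V) = g := hsub ⟨hz, z.2⟩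
            exact this ▸ hz
      obtain ⟨c, hc⟩ := hUne
      obtain ⟨z, hzU, hz⟩ := hD.inter_open_nonempty _ (hU'.preimage continuous_subtype_val)
        ⟨⟨j c, subset_closure (mem_range_self c)⟩, hc⟩
      rw [mem_iInter] at hz
      have hzG : (z : V) ∈ G := ⟨⟨z.2, hzU⟩, mem_iInter.2 fun n => hz (Sum.inl n)⟩
      exact hz (Sum.inr ⟨z, hzG⟩) rfl
    · obtain ⟨_, hxG, c, rfl⟩ := hmeet G (by
        let : MeasurableSpace V := borel V
        have : BorelSpace V := ⟨rfl⟩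
        exact (isClosed_closure.measurableSet.inter hU'.measurableSet).inter
          (MeasurableSet.iInter fun n => (hO n).measurableSet)) hG (fun x hx => hx.1.1)
      refine ⟨c, hxG.1.2, mem_iInter.2 fun n => ?_⟩
      rw [← hOf]
      exact mem_iInter.1 hxG.2 n

theorem mk_eq_continuum_of_measurableSet_borel {V : Type} [TopologicalSpace V] [PolishSpace V]
    {G : Set V} (hG : @MeasurableSet _ (borel V) G) (hc : ¬ G.Countable) : #G = 𝔠 := by
  let : MeasurableSpace V := borel V
  have : BorelSpace V := ⟨rfl⟩
  have := hG.standardBorel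
  have hc' : ¬ Countable G := fun h => hc (countable_coe_iff.1 h)
  rw [mk_congr (PolishSpace.measurableEquivNatBoolOfNotCountable hc').toEquiv]
  simp

end General

/-! ### The space `hull K E` -/

instance polishSpace_ternary : PolishSpace (ℕ → ZMod 3) := { }

section Space

variable {K : Set ((ℕ → ZMod 3) ≃ₜ (ℕ → ZMod 3))} {E F : Set (ℕ → ZMod 3)}

theorem add_mem_hull {x : ℕ → ZMod 3} (hx : x ∈ hull K E) (t : ℕ →₀ ZMod 3) :
    x + ⇑t ∈ hull K E :=
  (apply_mem_hull (g := Homeomorph.addRight (⇑t))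
    (Subgroup.subset_closure (Or.inl (mem_range_self t)))).2 hx

theorem nonempty_hull (h : ∀ t, Accomplished K E F t) : Nonempty (hull K E) := by
  obtain ⟨x, -, hx⟩ := h (.inr (.inl ⟨Set.univ, @MeasurableSet.univ _ (borel _)⟩)) (by
    rw [mk_univ, ← power_def, mk_nat, mk_fintype, ZMod.card]
    exact nat_power_aleph0 (n := 3) (by norm_num))
  exact ⟨x, hx⟩

theorem dense_hull (h : ∀ t, Accomplished K E F t) : Dense (hull K E) := by
  obtain ⟨x, hx⟩ := nonempty_hull h
  refine (dense_finTranslates x).mono ?_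
  rintro _ ⟨t, rfl⟩
  exact add_mem_hull hx t

instance neBot_nhdsNE_hull (x : hull K E) : (𝓝[≠] x).NeBot := by
  have h : Tendsto (fun n : ℕ => (⟨x + ⇑(Finsupp.single n (1 : ZMod 3)), add_mem_hull x.2 _⟩ :
      hull K E)) atTop (𝓝[≠] x) := by
    refine tendsto_nhdsWithin_iff.2 ⟨tendsto_subtype_rng.2 (tendsto_pi_nhds.2 fun i => ?_),
      Eventually.of_forall fun n h => ?_⟩
    · refine tendsto_const_nhds.congr' ?_
      filter_upwards [eventually_gt_atTop i] with n hn
      simp [hn.ne']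
    · have := congrFun (congrArg Subtype.val h) n
      simp at this
  exact h.neBot

/-- The restriction to `hull K E` of an element of `stageGroup K`. -/
def restrictHull {g : (ℕ → ZMod 3) ≃ₜ (ℕ → ZMod 3)} (hg : g ∈ stageGroup K) :
    hull K E ≃ₜ hull K E :=
  g.subtype fun _ => (apply_mem_hull hg).symm

theorem isCountableDenseHomogeneous_hull (hEF : Disjoint (hull K E) (hull K F))
    (h : ∀ t, Accomplished K E F t) : IsCountableDenseHomogeneous (hull K E) := by
  intro A B hA hA' hB hB'
  have := nonempty_hull h
  obtain ⟨a, rfl⟩ := hA.exists_eq_range hA'.nonempty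
  obtain ⟨b, rfl⟩ := hB.exists_eq_range hB'.nonempty
  have hval : DenseRange (Subtype.val : hull K E → ℕ → ZMod 3) := (dense_hull h).denseRange_val
  rcases h (.inl (fun n => a n, fun n => b n)) (hval.comp hA' continuous_subtype_val)
    (hval.comp hB' continuous_subtype_val) with ⟨x, hx, hxF⟩ | ⟨g, hg, hgab⟩
  · rcases hx with ⟨n, rfl⟩ | ⟨n, rfl⟩
    · exact (disjoint_left.1 hEF (a n).2 hxF).elim
    · exact (disjoint_left.1 hEF (b n).2 hxF).elim
  · have hiff : ∀ x : hull K E, restrictHull hg x ∈ range b ↔ x ∈ range a := by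
      intro x
      have := hgab x
      simp only [mem_range, Subtype.ext_iff] at this ⊢
      exact this
    refine ⟨restrictHull hg, Subset.antisymm ?_ fun y hy => ?_⟩
    · rintro _ ⟨x, hx, rfl⟩
      exact (hiff x).2 hx
    · refine ⟨(restrictHull hg).symm y, (hiff _).1 ?_, Homeomorph.apply_symm_apply _ _⟩
      rwa [Homeomorph.apply_symm_apply]

/-- Orbits are open, and the finitely supported translations carry every point into each nonempty
open set. -/
theorem isHomogeneousSpace_hull (hEF : Disjoint (hull K E) (hull K F))
    (h : ∀ t, Accomplished K E F t) : IsHomogeneousSpace (hull K E) := by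
  intro x y
  obtain ⟨U, hU, hUx⟩ :=
    isOpen_induced_iff.1 ((isCountableDenseHomogeneous_hull hEF h).isOpen_orbit x)
  have hxU : (x : ℕ → ZMod 3) ∈ U := by
    change x ∈ (Subtype.val ⁻¹' U : Set (hull K E))
    rw [hUx]
    exact ⟨Homeomorph.refl _, rfl⟩
  obtain ⟨_, hzU, t, rfl⟩ := (dense_finTranslates y).inter_open_nonempty U hU ⟨x, hxU⟩
  have hz : (⟨y + ⇑t, add_mem_hull y.2 t⟩ : hull K E) ∈ (Subtype.val ⁻¹' U : Set (hull K E)) := hzU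
  rw [hUx] at hz
  obtain ⟨g, hg⟩ := hz
  have ht : Homeomorph.addRight (⇑t) ∈ stageGroup K :=
    Subgroup.subset_closure (Or.inl (mem_range_self t))
  refine ⟨g.trans (restrictHull ht).symm, ?_⟩
  rw [Homeomorph.trans_apply, hg, Homeomorph.symm_apply_eq]
  rfl

theorem isCompletelyBaire_hull (h : ∀ t, Accomplished K E F t) :
    IsCompletelyBaire (hull K E) := by
  intro C hC
  refine (IsInducing.subtypeVal.comp IsInducing.subtypeVal).baireSpace_of_inter_nonempty
    (Subtype.val_injective.comp Subtype.val_injective) fun G hG hGc hGC => ?_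
  obtain ⟨x, hxG, hx⟩ := h (.inr (.inl ⟨G, hG⟩)) (mk_eq_continuum_of_measurableSet_borel hG hGc)
  refine ⟨x, hxG, ?_⟩
  have hxC : (⟨x, hx⟩ : hull K E) ∈ closure C := by
    rw [closure_subtype]
    have := hGC hxG
    rwa [range_comp, Subtype.range_val] at this
  rw [hC.closure_eq] at hxC
  exact ⟨⟨_, hxC⟩, rfl⟩

/-- A homeomorphism from a product of two countable dense sets onto a dense set on which the first
coordinate is injective cannot have a first component that depends on one coordinate only
in some open box; hence its first component takes a value outside the space. -/
theorem not_isCountableDenseHomogeneous_hull_prod (hEF : Disjoint (hull K E) (hull K F))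
    (h : ∀ t, Accomplished K E F t) : ¬ IsCountableDenseHomogeneous (hull K E × hull K E) := by
  intro hcdh
  have := nonempty_hull h
  obtain ⟨A, hAc, hA⟩ := TopologicalSpace.exists_countable_dense (hull K E)
  obtain ⟨D, hDc, hD, hDinj⟩ := exists_countable_dense_injOn_fst (hull K E)
  obtain ⟨g, hg⟩ := hcdh (A ×ˢ A) D (hAc.prod hAc) (hA.prod hA) hDc hD
  have hinj : ∀ p ∈ A ×ˢ A, ∀ q ∈ A ×ˢ A, (g p).1 = (g q).1 → p = q := fun p hp q hq hpq =>
    g.injective (hDinj (hg ▸ mem_image_of_mem g hp) (hg ▸ mem_image_of_mem g hq) hpq)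
  obtain ⟨d, hd⟩ := (hAc.prod hAc).exists_eq_range (hA.prod hA).nonempty
  let c : ℕ → (ℕ → ZMod 3) × (ℕ → ZMod 3) × (ℕ → ZMod 3) :=
    fun n => ((d n).1, (d n).2, (g (d n)).1)
  let ι : (hull K E × hull K E) × (ℕ → ZMod 3) → (ℕ → ZMod 3) × (ℕ → ZMod 3) × (ℕ → ZMod 3) :=
    fun p => (p.1.1, p.1.2, p.2)
  have hval : DenseRange (Subtype.val : hull K E → ℕ → ZMod 3) := (dense_hull h).denseRange_val
  have hι : IsInducing ι :=
    (Homeomorph.prodAssoc _ _ _).isInducing.comp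
      ((IsInducing.subtypeVal.prodMap IsInducing.subtypeVal).prodMap IsInducing.id)
  have hgraph : ∀ (x y : hull K E) (v : ℕ → ZMod 3),
      ((x : ℕ → ZMod 3), (y : ℕ → ZMod 3), v) ∈ closure (range c) → (g (x, y)).1 = v := by
    intro x y v hv
    let s : Set ((hull K E × hull K E) × (ℕ → ZMod 3)) :=
      range fun n => (d n, ((g (d n)).1 : ℕ → ZMod 3))
    have hs : ι '' s = range c := by
      rw [← range_comp]; rfl
    have : ((x, y), v) ∈ closure s := by
      rw [hι.closure_eq_preimage_closure_image, hs]
      exact hv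
    have hcl : IsClosed {p : (hull K E × hull K E) × (ℕ → ZMod 3) |
        ((g p.1).1 : ℕ → ZMod 3) = p.2} :=
      isClosed_eq (by fun_prop) continuous_snd
    exact closure_minimal (by rintro _ ⟨n, rfl⟩; rfl) hcl this
  have htotal : ∀ x y, ∃ v, (x, y, v) ∈ closure (range c) := by
    intro x y
    let π : (ℕ → ZMod 3) × (ℕ → ZMod 3) × (ℕ → ZMod 3) → (ℕ → ZMod 3) × (ℕ → ZMod 3) :=
      fun p => (p.1, p.2.1)
    have hcl : IsClosed (π '' closure (range c)) :=
      (isClosed_closure.isCompact.image (by fun_prop)).isClosed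
    have hdense : DenseRange fun n => (((d n).1 : ℕ → ZMod 3), ((d n).2 : ℕ → ZMod 3)) := by
      refine (hval.prodMap hval).comp (f := d) ?_
        (continuous_subtype_val.prodMap continuous_subtype_val)
      rw [DenseRange, ← hd]
      exact hA.prod hA
    have : (x, y) ∈ π '' closure (range c) := by
      refine closure_minimal ?_ hcl (hdense (x, y))
      rintro _ ⟨n, rfl⟩
      exact ⟨c n, subset_closure (mem_range_self n), rfl⟩
    obtain ⟨⟨x', y', v⟩, hv, hxy⟩ := this
    obtain ⟨rfl, rfl⟩ := Prod.mk.inj hxy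
    exact ⟨v, hv⟩
  have hbox : ∀ I : Set ((ℕ → ZMod 3) × (ℕ → ZMod 3)), IsOpen I → I.Nonempty →
      ∃ U W : Set (hull K E), IsOpen U ∧ IsOpen W ∧ U.Nonempty ∧ W.Nonempty ∧
        ∀ x ∈ U, ∀ y ∈ W, ((x : ℕ → ZMod 3), (y : ℕ → ZMod 3)) ∈ I := by
    intro I hI hIne
    obtain ⟨_, hpI, ⟨x, y⟩, rfl⟩ := (hval.prodMap hval).inter_open_nonempty I hI hIne
    obtain ⟨U, W, hU, hW, hx, hy, hUW⟩ := isOpen_prod_iff.1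
      (hI.preimage (continuous_subtype_val.prodMap continuous_subtype_val)) x y hpI
    exact ⟨U, W, hU, hW, ⟨x, hx⟩, ⟨y, hy⟩, fun a ha b hb => hUW (mk_mem_prod ha hb)⟩
  have htwo : ∀ U : Set (hull K E), IsOpen U → U.Nonempty → ∃ a ∈ A, ∃ b ∈ A, a ∈ U ∧ b ∈ U ∧
      a ≠ b := by
    intro U hU hUne
    obtain ⟨a, haU, ha⟩ := hA.inter_open_nonempty U hU hUne
    obtain ⟨b, hbU, hb⟩ := (hA.sdiff_singleton a).inter_open_nonempty U hU hUne
    exact ⟨a, ha, b, hb.1, haU, hbU, fun hab => hb.2 hab.symm⟩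
  rcases h (.inr (.inr c)) htotal with ⟨u, hu | hu⟩ | ⟨x, hx, y, hy, v, hv, hxyv⟩
  · obtain ⟨U, W, hU, hW, hUne, hWne, hI⟩ := hbox _ isOpen_interior hu
    obtain ⟨a, haU, ha⟩ := hA.inter_open_nonempty U hU hUne
    obtain ⟨b, hb, b', hb', hbW, hbW', hne⟩ := htwo W hW hWne
    have h1 := interior_subset (hI a haU b hbW)
    replace h1 := hgraph a b _ h1
    have h2 := interior_subset (hI a haU b' hbW')
    replace h2 := hgraph a b' _ h2
    exact hne (congrArg Prod.snd
      (hinj (a, b) ⟨ha, hb⟩ (a, b') ⟨ha, hb'⟩ (Subtype.ext (h1.trans h2.symm))))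
  · obtain ⟨U, W, hU, hW, hUne, hWne, hI⟩ := hbox _ isOpen_interior hu
    obtain ⟨a, haW, ha⟩ := hA.inter_open_nonempty W hW hWne
    obtain ⟨b, hb, b', hb', hbU, hbU', hne⟩ := htwo U hU hUne
    have h1 := interior_subset (hI b hbU a haW)
    replace h1 := hgraph b a _ h1
    have h2 := interior_subset (hI b' hbU' a haW)
    replace h2 := hgraph b' a _ h2
    exact hne (congrArg Prod.fst
      (hinj (b, a) ⟨hb, ha⟩ (b', a) ⟨hb', ha⟩ (Subtype.ext (h1.trans h2.symm))))
  · have := hgraph ⟨x, hx⟩ ⟨y, hy⟩ v hxyv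
    exact disjoint_left.1 hEF (this ▸ Subtype.coe_prop _) hv

end Space

theorem exists_isEmbedding_ternary : ∃ e : (ℕ → ZMod 3) → ℕ → Bool, IsEmbedding e := by
  let e : (ℕ → ZMod 3) → ℕ → Bool := fun x n => decide (x n.unpair.1 = n.unpair.2)
  have hcont : Continuous e := continuous_pi fun n =>
    (continuous_of_discreteTopology (f := fun z : ZMod 3 => decide (z = n.unpair.2))).comp
      (continuous_apply n.unpair.1)
  have hinj : Function.Injective e := by
    intro x y hxy
    ext1 n
    have := congrFun hxy (Nat.pair n (x n).val)
    simp only [e, Nat.unpair_pair, ZMod.natCast_val, ZMod.cast_id', id_eq, decide_true] at this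
    exact (of_decide_eq_true this.symm).symm
  exact ⟨e, (hcont.isClosedEmbedding hinj).isEmbedding⟩

theorem theorem1p4 (hMA : MASigmaCentered) :
    ∃ X : Set (ℕ → Bool),
      TopologicalSpace.MetrizableSpace X ∧ TopologicalSpace.SeparableSpace X ∧
      IsZeroDimensional X ∧
      IsCountableDenseHomogeneous X ∧ ¬ IsCountableDenseHomogeneous (X × X) ∧
      IsHomogeneousSpace X ∧ IsCompletelyBaire X := by
  obtain ⟨K, E, F, hEF, h⟩ := hMA.exists_forall_accomplished
  obtain ⟨e, he⟩ := exists_isEmbedding_ternary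
  let φ : hull K E ≃ₜ e '' hull K E := he.homeomorphImage _
  refine ⟨e '' hull K E, inferInstance, inferInstance, ?_,
    (isCountableDenseHomogeneous_hull hEF h).of_homeomorph φ,
    fun hc => not_isCountableDenseHomogeneous_hull_prod hEF h
      (hc.of_homeomorph (φ.prodCongr φ).symm),
    (isHomogeneousSpace_hull hEF h).of_homeomorph φ, (isCompletelyBaire_hull h).of_homeomorph φ⟩
  refine TopologicalSpace.isTopologicalBasis_of_isOpen_of_nhds (fun s hs => hs.isOpen) ?_
  rintro x _ hx ⟨U, hU, rfl⟩
  obtain ⟨V, hV, hxV, hVU⟩ := (isTopologicalBasis_isClopen (X := ℕ → Bool)).mem_nhds_iff.1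
    (hU.mem_nhds hx)
  exact ⟨Subtype.val ⁻¹' V, hV.preimage continuous_subtype_val, hxV, preimage_mono hVU⟩
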